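/- **Notation.** Write $(x)_k=x(x-1)\cdots(x-k+1)$. For weights $w_1,\dots,w_k$ let $$\Sigma_{(k,m,s)}[w]=\sum\binom{m-s}{n_1,\dots,n_k}w_1^{n_1}\cdots w_k^{n_k},$$ the sum being over all nonnegative integers $n_1,\dots,n_k$ with $n_1+2n_2+\cdots+kn_k=m$ and $n_1+\cdots+n_k=m-s$. For a function $f(x)=x+\sum_{m\ge1}a_mx^{m\tau+1}$ near $0$ (with $\tau\ge1$ an integer and $a_1<0$) put $\lambda=-1/(\tau a_1)$ and $$b_j=\lambda^{j+1}\sum_{s=0}^{j}\frac{(-\tau)_{j+1-s}}{(j+1-s)!}\,\Sigma_{(7,j+1,s)}[a_1,\dots,a_7]\quad(1\le j\le 6),$$ $$a_{0,j}=\sum_{s=0}^{j-1}\frac{(-1)^{j-1-s}}{j-s}\,\Sigma_{(7,j,s)}[1,b_1,\dots,b_6],\qquad a_{i,j}=\sum_{s=0}^{j-i-1}\frac{(-i)_{j-i-s}}{(j-i-s)!}\,\Sigma_{(7,j-i,s)}[1,b_1,\dots,b_6]\quad(1\le i<j\le 6),$$ $$c_0=-b_1,\qquad c_i=\frac1i\Big(b_{i+1}+\sum_{h=0}^{i-1}a_{h,i+1}c_h\Big)\quad(1\le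 i\le5),$$ and define polynomials by $T_1=X$, $T_2=b_1X-c_1$ and, for $2\le m\le5$, $$T_{m+1}=b_1\sum_{s=0}^{m-1}\frac{(-1)^{m-1-s}}{m-s}\Sigma_{(m,m,s)}[T_1,\dots,T_m]-c_m-\sum_{p=1}^{m-1}c_p\sum_{q=1}^{m-p}\frac{(-p)_q}{q!}\Sigma_{(m,m-p,m-p-q)}[T_1,\dots,T_m],$$ and by $P_0=1$, $P_1=X$ and, for $2\le m\le 6$, $$P_m=\sum_{s=0}^{m-1}\frac{(-1/\tau)_{m-s}}{(m-s)!}\Sigma_{(6,m,s)}[T_1(-\tau X),\dots,T_6(-\tau X)].$$ **Statement.** Let $f(x)=1-e^{-x}$ and $\tau=1$. (1) One has $(a_m)_{m=1}^7=(-\frac12,\frac16,-\frac1{24},\frac1{120},-\frac1{720},\frac1{5040},-\frac1{40320})$, $\lambda=2$, $(b_j)_{j=1}^6=(\frac13,0,-\frac1{45},0,\frac2{945},0)$, $(a_{0,j})_{j=1}^6=(1,-\frac16,0,\frac1{180},0,-\frac1{2835})$, $(c_i)_{i=1}^5=(\frac1{18},\frac1{135},-\frac1{972},-\frac{71}{27216},-\frac{8759}{5103000})$,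 $T_2=\frac13X-\frac1{18}$, $T_3=-\frac16X^2+\frac16X-\frac7{270}$, $T_4=\frac19X^3-\frac29X^2+\frac{29}{270}X-\frac{13}{1215}$, $P_2=X^2+\frac13X+\frac1{18}$, $P_3=X^3+\frac56X^2+\frac5{18}X+\frac7{270}$, $P_4=X^4+\frac{13}9X^3+\frac56X^2+\frac{53}{270}X+\frac{67}{4860}$. (2) For every $x_0>0$ there is a constant $C=C(x_0)$ such that the sequence $x_n=1-\exp(-x_{n-1})$, $n\ge1$, satisfies, as $n\to\infty$, $$x_n=\Big(\frac{\lambda}{n}\Big)^{1/\tau}\Big\{1+\sum_{m=1}^4P_m\Big(-\frac1\tau[b_1\ln n-2C]\Big)\frac1{n^m}\Big\}+O\Big(\frac{\ln^5n}{n^6}\Big),$$ and, with the same $C$, $$\begin{aligned}x_n={}&\frac2n-\frac23\frac{\ln n}{n^2}+\frac{4C}{n^2}+\frac29\frac{\ln^2n}{n^3}-\Big(\frac83C+\frac29\Big)\frac{\ln n}{n^3}+\Big(8C^2+\frac43C+\frac19\Big)\frac1{n^3}\\&-\frac2{27}\frac{\ln^3n}{n^4}+\Big(\frac43C+\frac5{27}\Big)\frac{\ln^2n}{n^4}-\Big(8C^2+\frac{20}9C+\frac5{27}\Big)\frac{\ln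 n}{n^4}+\Big(16C^3+\frac{20}3C^2+\frac{10}9C+\frac7{135}\Big)\frac1{n^4}\\&+\frac2{81}\frac{\ln^4n}{n^5}-\Big(\frac{16}{27}C+\frac{26}{243}\Big)\frac{\ln^3n}{n^5}+\Big(\frac{16}3C^2+\frac{52}{27}C+\frac5{27}\Big)\frac{\ln^2n}{n^5}\\&-\Big(\frac{64}3C^3+\frac{104}9C^2+\frac{20}9C+\frac{53}{405}\Big)\frac{\ln n}{n^5}+\Big(32C^4+\frac{208}9C^3+\frac{20}3C^2+\frac{106}{135}C+\frac{67}{2430}\Big)\frac1{n^5}+O\Big(\frac{\ln^5n}{n^6}\Big).\end{aligned}$$ (3) $g(x)=\ln(1+x)$ and $f$ are kindred: for both functions $h\in\{f,g\}$ there is $\varepsilon>0$ such that for each $0<x_0<\varepsilon$ there is a constant $K$ for which the iterates $x_n=h(x_{n-1})$ satisfy $x_n=\frac{\lambda}{n}\{1+\sum_{m=1}^4P_m(-[b_1\ln n+K])n^{-m}\}+O(\ln^5n/n^6)$, with the $\lambda,b_1,P_m$ belonging to $h$; and all corresponding coefficients agree up to sign. Precisely, with superscripts $f,g$ for the data of the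 two functions, $\lambda^f=\lambda^g$; $c_i^f=(-1)^{i+1}c_i^g$ for $1\le i\le5$; for $1\le m\le6$ and all $j$ the coefficients of $X^j$ satisfy $[X^j]T^f_m=(-1)^{m+j}[X^j]T^g_m$ and $[X^j]P^f_m=(-1)^{m+j}[X^j]P^g_m$; and $P^f_m(-[b^f_1l-K])=(-1)^mP^g_m(-[b^g_1l+K])$ for all real $l,K$ and $1\le m\le6$. -/

import Mathlib

open Asymptotics Filter Polynomial

namespace IterAsymp

noncomputable section

/-- The Taylor coefficient `a_m` of `x ^ (m * τ + 1)` in the expansion at the origin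
`f x = x + ∑ a_m x ^ (m * τ + 1)`. -/
def taylorCoeff (f : ℝ → ℝ) (τ m : ℕ) : ℝ :=
  iteratedDeriv (m * τ + 1) f 0 / ((m * τ + 1).factorial : ℝ)

/-- The symbol `(x)_k = x (x - 1) ⋯ (x - k + 1)`. -/
def fall (x : ℝ) (k : ℕ) : ℝ := ∏ i ∈ Finset.range k, (x - i)

/-- The sum `∑_{(k,m,s)}` of `multinomial(m - s; n_1, …, n_k) w_1 ^ n_1 ⋯ w_k ^ n_k` over all
nonnegative integers `n_1, …, n_k` with `n_1 + 2 n_2 + ⋯ + k n_k = m` and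
`n_1 + ⋯ + n_k = m - s` (used only for `s ≤ m`). The index `i : Fin k` stands for `i + 1`. -/
def partSum {R : Type*} [CommSemiring R] (k m s : ℕ) (w : Fin k → R) : R :=
  ∑ n ∈ ((Finset.univ : Finset (Fin k)).piAntidiag (m - s)).filter
      (fun n => ∑ i : Fin k, ((i : ℕ) + 1) * n i = m),
    (Nat.multinomial Finset.univ n : R) * ∏ i : Fin k, w i ^ n i

/-- `λ = -1 / (τ a_1)`. -/
def lam (τ : ℕ) (a : ℕ → ℝ) : ℝ := -1 / (τ * a 1)

/-- The numbers `b_j` (for `1 ≤ j ≤ 6`). -/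
def b (τ : ℕ) (a : ℕ → ℝ) (j : ℕ) : ℝ :=
  lam τ a ^ (j + 1) * ∑ s ∈ Finset.range (j + 1),
    fall (-(τ : ℝ)) (j + 1 - s) / ((j + 1 - s).factorial : ℝ) *
      partSum 7 (j + 1) s (fun i => a ((i : ℕ) + 1))

/-- The seven weights `1, b_1, …, b_6`. -/
def bWeight (τ : ℕ) (a : ℕ → ℝ) (i : Fin 7) : ℝ := if (i : ℕ) = 0 then 1 else b τ a i

/-- The numbers `a_{i,j}` (for `0 ≤ i < j ≤ 6`). -/
def aa (τ : ℕ) (a : ℕ → ℝ) (i j : ℕ) : ℝ :=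
  if i = 0 then
    ∑ s ∈ Finset.range j, (-1 : ℝ) ^ (j - 1 - s) / ((j - s : ℕ) : ℝ) *
      partSum 7 j s (bWeight τ a)
  else
    ∑ s ∈ Finset.range (j - i), fall (-(i : ℝ)) (j - i - s) / ((j - i - s).factorial : ℝ) *
      partSum 7 (j - i) s (bWeight τ a)

/-- The numbers `c_i` (for `0 ≤ i ≤ 5`). -/
def c (τ : ℕ) (a : ℕ → ℝ) : ℕ → ℝ
  | 0 => -b τ a 1
  | i + 1 => 1 / ((i : ℝ) + 1) *
      (b τ a (i + 2) + ∑ h : Fin (i + 1), aa τ a h (i + 2) * c τ a h)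
termination_by i => i
decreasing_by exact h.2

/-- The polynomials `T_m` (for `1 ≤ m ≤ 6`; the value at `0` is a dummy). The last clause,
with `m + 1` the recursion index, also gives `T_2 = b_1 X - c_1`. -/
def T (τ : ℕ) (a : ℕ → ℝ) : ℕ → ℝ[X]
  | 0 => 0
  | 1 => X
  | m + 2 =>
      C (b τ a 1) * ∑ s ∈ Finset.range (m + 1),
          C ((-1 : ℝ) ^ (m - s) / ((m + 1 - s : ℕ) : ℝ)) *
            partSum (m + 1) (m + 1) s (fun i : Fin (m + 1) => T τ a ((i : ℕ) + 1))
        - C (c τ a (m + 1))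
        - ∑ p ∈ Finset.Icc 1 m, C (c τ a p) * ∑ q ∈ Finset.Icc 1 (m + 1 - p),
            C (fall (-(p : ℝ)) q / (q.factorial : ℝ)) *
              partSum (m + 1) (m + 1 - p) (m + 1 - p - q)
                (fun i : Fin (m + 1) => T τ a ((i : ℕ) + 1))
termination_by m => m
decreasing_by all_goals exact Nat.succ_lt_succ i.2

/-- The polynomials `P_m` (for `0 ≤ m ≤ 6`), where `T_m(-τ X)` is the weight number `m`. -/
def P (τ : ℕ) (a : ℕ → ℝ) : ℕ → ℝ[X]
  | 0 => 1
  | 1 => X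
  | m + 2 =>
      ∑ s ∈ Finset.range (m + 2),
        C (fall (-(1 / (τ : ℝ))) (m + 2 - s) / ((m + 2 - s).factorial : ℝ)) *
          partSum 6 (m + 2) s
            (fun i : Fin 6 => (T τ a ((i : ℕ) + 1)).comp (C (-(τ : ℝ)) * X))

/-- The expression
`(λ / n) ^ (1 / τ) * (1 + ∑_{m = 1}^N P_m (-(1 / τ) [b_1 ln n + K]) / n ^ m)`. -/
def approx (τ : ℕ) (a : ℕ → ℝ) (N : ℕ) (K : ℝ) (n : ℕ) : ℝ :=
  (lam τ a / n) ^ (1 / (τ : ℝ)) *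
    (1 + ∑ m ∈ Finset.Icc 1 N,
      (P τ a m).eval (-(1 / (τ : ℝ)) * (b τ a 1 * Real.log n + K)) / (n : ℝ) ^ m)

/-- The iterates of `f` from every small positive initial value `x₀` satisfy, for some
constant `K = K(x₀)`, the expansion `approx` to order `N`, with an error of the size of
the next block of terms. -/
def IteratesExpand (f : ℝ → ℝ) (τ N : ℕ) : Prop :=
  ∃ ε > 0, ∀ x₀ : ℝ, 0 < x₀ → x₀ < ε → ∃ K : ℝ,
    (fun n : ℕ => f^[n] x₀ - approx τ (taylorCoeff f τ) N K n) =O[atTop]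
      (fun n : ℕ => Real.log n ^ (N + 1) / (n : ℝ) ^ ((N : ℝ) + 1 + 1 / (τ : ℝ)))

/-- `f` and `g` are kindred, with expansions taken to order `N ≤ 6`: the iterates of both have
asymptotic expansions, and all corresponding coefficients of the `c_i`, of the polynomials `T_m`
and `P_m`, and of the two expansions are equal up to sign, with the sign pattern displayed. In
`block` the two sides are the coefficients of `1 / n ^ m` (relative to the leading term) as
polynomials in `ln n = l` and the constant; the constant enters with opposite signs. -/
structure Kindred (f g : ℝ → ℝ) (τ N : ℕ) : Prop where
  expand_left : IteratesExpand f τ N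
  expand_right : IteratesExpand g τ N
  lam_eq : lam τ (taylorCoeff f τ) = lam τ (taylorCoeff g τ)
  c_eq : ∀ i, 1 ≤ i → i ≤ 5 →
    c τ (taylorCoeff g τ) i = (-1) ^ (i + 1) * c τ (taylorCoeff f τ) i
  T_eq : ∀ m, 1 ≤ m → m ≤ 6 → ∀ j,
    (T τ (taylorCoeff g τ) m).coeff j = (-1) ^ (m + j) * (T τ (taylorCoeff f τ) m).coeff j
  P_eq : ∀ m, 1 ≤ m → m ≤ 6 → ∀ j,
    (P τ (taylorCoeff g τ) m).coeff j = (-1) ^ (m + j) * (P τ (taylorCoeff f τ) m).coeff j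
  block : ∀ m, 1 ≤ m → m ≤ 6 → ∀ l K : ℝ,
    (P τ (taylorCoeff g τ) m).eval (-(1 / (τ : ℝ)) * (b τ (taylorCoeff g τ) 1 * l - K)) =
      (-1) ^ m *
        (P τ (taylorCoeff f τ) m).eval (-(1 / (τ : ℝ)) * (b τ (taylorCoeff f τ) 1 * l + K))

end

end IterAsymp

/-! The asymptotics come from an approximate Abel function. For `σ = 1` (`1 - exp (-x)`) and `σ =
-1` (`log (1 + x)`) put `A x = 2/x + (σ/3) log x + x/36 + σ x²/540 - x³/7776`; the coefficients of
`x, x², x³` are `c_i / λ ^ i` with `λ = 2`. It satisfies `A (h x) = A x + 1 + O(x⁵)`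
(`abel_f_isBigO`, `abel_g_isBigO`). Along an orbit this forces `n x_n → 2`, so the defects are
`O(n⁻⁵)`, summable, and `A (x_n) = n + K' + O(n⁻⁴)` (`abelFun_orbit`).

It remains to invert `A`. The trial value `2/n * (1 + blocks)`, built from `P_1, …, P_4`, satisfies
the same relation up to `O(log⁵ n / n⁴)` (`abelFun_blocks`). Since `A` behaves like `2/x`, `|x - y|
≤ x y |A x - A y|` on `(0, 1]` (`abs_sub_le_abelFun`), and both points are `O(1/n)`: the error gains
a factor `n⁻²`.

The two functions are kindred because `log (1 + x)` is the inverse of `1 - exp (-x)` conjugated by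
`x ↦ -x`; accordingly `A₋₁ x = -A₁ (-x)`. Algebraically, once `b_1` and the `c_i` are known to match
up to sign, homogeneity carries the signs through the recursions for `T_m` and `P_m` (`T_reflect`,
`P_reflect`).

The numerical parameters are finite computations in `ℚ`: each sum over partitions is a coefficient
of a power of a series, given by the simple recursion `powCoeff`. -/

namespace IterAsymp

/-! ### Partition sums as coefficients of powers of a series -/

/-- The coefficient of `z ^ m` in `(W 0 * z + W 1 * z ^ 2 + ⋯) ^ l`. -/
def powCoeff {R : Type*} [CommSemiring R] (W : ℕ → R) : ℕ → ℕ → R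
  | 0, m => if m = 0 then 1 else 0
  | l + 1, m => ∑ i ∈ Finset.range m, W i * powCoeff W l (m - 1 - i)

/-- Multinomial theorem: the condition `∑ (i + 1) * n i = m` selects the exponent of `X`. -/
theorem partSum_eq_coeff {R : Type*} [CommSemiring R] (k m s : ℕ) (w : Fin k → R) :
    partSum k m s w =
      ((∑ i : Fin k, Polynomial.C (w i) * X ^ ((i : ℕ) + 1)) ^ (m - s)).coeff m := by
  rw [Finset.sum_pow_eq_sum_piAntidiag, finsetSum_coeff, partSum, Finset.sum_filter]
  refine Finset.sum_congr rfl fun n _ => ?_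
  have h : (Nat.multinomial Finset.univ n : R[X]) *
      ∏ i : Fin k, (Polynomial.C (w i) * X ^ ((i : ℕ) + 1)) ^ n i =
      Polynomial.C ((Nat.multinomial Finset.univ n : R) * ∏ i : Fin k, w i ^ n i) *
        X ^ (∑ i : Fin k, ((i : ℕ) + 1) * n i) := by
    simp only [mul_pow, Finset.prod_mul_distrib, ← pow_mul, Finset.prod_pow_eq_pow_sum,
      map_mul, map_natCast, map_prod, map_pow, mul_assoc]
  rw [h, coeff_C_mul_X_pow]
  simp only [eq_comm]

/-- Weights of index above `m` cannot reach degree `m`, so the truncation at `k ≥ m` is invisible.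
This puts the sums with `k = 6`, `k = 7` and `k = m` on the same footing. -/
theorem coeff_pow_eq_powCoeff {R : Type*} [CommSemiring R] (k : ℕ) (W : ℕ → R) (l m : ℕ)
    (hm : m ≤ k) :
    ((∑ i : Fin k, Polynomial.C (W i) * X ^ ((i : ℕ) + 1)) ^ l).coeff m = powCoeff W l m := by
  induction l generalizing m with
  | zero => simp [powCoeff, coeff_one]
  | succ l ih =>
    rw [pow_succ', Finset.sum_mul, finsetSum_coeff, powCoeff]
    generalize hQ : (∑ i : Fin k, Polynomial.C (W i) * X ^ ((i : ℕ) + 1)) ^ l = Q at ih ⊢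
    refine (Fin.sum_univ_eq_sum_range
      (fun i : ℕ => (Polynomial.C (W i) * X ^ (i + 1) * Q).coeff m) k).trans ?_
    rw [← Finset.sum_subset (Finset.range_subset_range.2 hm)]
    · refine Finset.sum_congr rfl fun i hi => ?_
      have hi := Finset.mem_range.1 hi
      rw [← ih _ (by omega), mul_assoc, coeff_C_mul, coeff_X_pow_mul', if_pos (by omega)]
      congr 2
      omega
    · intro i _ hi
      rw [Finset.mem_range] at hi
      rw [mul_assoc, coeff_C_mul, coeff_X_pow_mul', if_neg (by omega), mul_zero]

theorem partSum_eq_powCoeff {R : Type*} [CommSemiring R] {k m : ℕ} (hm : m ≤ k) (s : ℕ)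
    (W : ℕ → R) : partSum k m s (fun i => W i) = powCoeff W (m - s) m := by
  rw [partSum_eq_coeff, coeff_pow_eq_powCoeff k W _ m hm]

theorem map_powCoeff {R S : Type*} [CommSemiring R] [CommSemiring S] (φ : R →+* S)
    (W : ℕ → R) (l m : ℕ) : φ (powCoeff W l m) = powCoeff (fun i => φ (W i)) l m := by
  induction l generalizing m with
  | zero => simp [powCoeff, apply_ite φ]
  | succ l ih => simp [powCoeff, map_sum, ih]

/-- Substituting `ε z` for `z` in the series. With `ε = -1` this is the source of all sign patterns.
-/
theorem powCoeff_scale {R : Type*} [CommSemiring R] (ε : R) (V W : ℕ → R) (l m : ℕ)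
    (h : ∀ i < m, V i = ε ^ (i + 1) * W i) : powCoeff V l m = ε ^ m * powCoeff W l m := by
  induction l generalizing m with
  | zero =>
    rcases Nat.eq_zero_or_pos m with rfl | hm
    · simp [powCoeff]
    · simp [powCoeff, hm.ne']
  | succ l ih =>
    rw [powCoeff, powCoeff, Finset.mul_sum]
    refine Finset.sum_congr rfl fun i hi => ?_
    have hi := Finset.mem_range.1 hi
    rw [h i hi, ih _ fun j hj => h j (by omega)]
    obtain ⟨d, rfl⟩ : ∃ d, m = i + 1 + d := ⟨m - (i + 1), by omega⟩
    have : i + 1 + d - 1 - i = d := by omega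
    rw [this, pow_add]
    ring

theorem powCoeff_congr {R : Type*} [CommSemiring R] (V W : ℕ → R) (l m : ℕ)
    (h : ∀ i < m, V i = W i) : powCoeff V l m = powCoeff W l m := by
  simpa using powCoeff_scale 1 V W l m (by simpa using h)

/-! ### Exact rational values of the parameters -/

theorem b_eq (a : ℕ → ℝ) (j : ℕ) (hj : j ≤ 6) :
    b 1 a j = lam 1 a ^ (j + 1) * ∑ s ∈ Finset.range (j + 1), fall (-1) (j + 1 - s) /
      ((j + 1 - s).factorial : ℝ) * powCoeff (fun i => a (i + 1)) (j + 1 - s) (j + 1) := by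
  simp only [b, Nat.cast_one,
    partSum_eq_powCoeff (show j + 1 ≤ 7 by omega) _ (fun i => a (i + 1))]

theorem fall_neg_one (k : ℕ) : fall (-1) k = (-1) ^ k * (k.factorial : ℝ) := by
  induction k with
  | zero => simp [fall]
  | succ k ih =>
    have h : fall (-1) (k + 1) = fall (-1) k * (-1 - k) := by
      simp [fall, Finset.prod_range_succ]
    rw [h, ih, Nat.factorial_succ]
    push_cast
    ring

theorem lam_f {a : ℕ → ℝ} (h1 : a 1 = -1 / 2) : lam 1 a = 2 := by
  norm_num [lam, h1]

theorem fall_neg_one_div (k : ℕ) : fall (-1) k / (k.factorial : ℝ) = (-1) ^ k := by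
  rw [fall_neg_one, mul_div_cancel_right₀ _ (by positivity)]

/-- The rational number `b_j` of a function with Taylor coefficients `A 0, A 1, …` and `τ = 1`,
`λ = 2`. -/
def bRat (A : ℕ → ℚ) (j : ℕ) : ℚ :=
  2 ^ (j + 1) * ∑ s ∈ Finset.range (j + 1), (-1) ^ (j + 1 - s) * powCoeff A (j + 1 - s) (j + 1)

theorem b_eq_bRat {a : ℕ → ℝ} {A : ℕ → ℚ} (ha : ∀ i < 7, a (i + 1) = A i) (hl : lam 1 a = 2)
    {j : ℕ} (hj : j ≤ 6) : b 1 a j = bRat A j := by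
  rw [b_eq _ _ hj, hl, bRat]
  push_cast
  congr 1
  refine Finset.sum_congr rfl fun s _ => ?_
  rw [fall_neg_one_div, powCoeff_congr _ (fun i => Rat.castHom ℝ (A i)) _ _
    fun i hi => ha i (by omega), ← map_powCoeff, Rat.coe_castHom]

/-- The rational number `a_{i,j}` of a function with the weights `B 0, B 1, …`. -/
def aaRat (B : ℕ → ℚ) (i j : ℕ) : ℚ :=
  if i = 0 then ∑ s ∈ Finset.range j, (-1) ^ (j - 1 - s) / ((j - s : ℕ) : ℚ) * powCoeff B (j - s) j
  else ∑ s ∈ Finset.range (j - i), (∏ r ∈ Finset.range (j - i - s), (-(i : ℚ) - r)) /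
    ((j - i - s).factorial : ℚ) * powCoeff B (j - i - s) (j - i)

theorem aa_eq_aaRat {a : ℕ → ℝ} {B : ℕ → ℚ} (hB : ∀ i : Fin 7, bWeight 1 a i = B i)
    {i j : ℕ} (hj : j ≤ 6) : aa 1 a i j = aaRat B i j := by
  have key : ∀ m s, m ≤ 6 → partSum 7 m s (bWeight 1 a) = (powCoeff B (m - s) m : ℚ) := by
    intro m s hm
    have h : bWeight 1 a = fun i : Fin 7 => ((B i : ℚ) : ℝ) := funext hB
    refine h ▸ (partSum_eq_powCoeff (by omega) s fun n => ((B n : ℚ) : ℝ)).trans ?_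
    exact (map_powCoeff (Rat.castHom ℝ) B _ _).symm
  unfold aa aaRat
  split_ifs with h
  · simp only [key _ _ hj]
    push_cast
    rfl
  · simp only [key _ _ (show j - i ≤ 6 by omega), fall]
    push_cast
    rfl

/-- The list `A`, continued by zeros. -/
def ofList (A : List ℚ) (i : ℕ) : ℚ := A.getD i 0

/-- The Taylor coefficients of `1 - exp (-x)`, from that of `x ^ 2` on. -/
def taylorF : List ℚ := [-1/2, 1/6, -1/24, 1/120, -1/720, 1/5040, -1/40320]

/-- The Taylor coefficients of `log (1 + x)`, from that of `x ^ 2` on. -/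
def taylorG : List ℚ := [-1/2, 1/3, -1/4, 1/5, -1/6, 1/7, -1/8]

/-- The weights `1, b_1, …, b_6` of `1 - exp (-x)`. -/
def weightsF : List ℚ := [1, 1/3, 0, -1/45, 0, 2/945, 0]

/-- The weights `1, b_1, …, b_6` of `log (1 + x)`. -/
def weightsG : List ℚ := [1, -1/3, 1/3, -19/45, 3/5, -863/945, 275/189]

theorem b_eq_ofList {a : ℕ → ℝ} {A B : List ℚ} (ha : ∀ i < 7, a (i + 1) = ofList A i)
    (h0 : ofList A 0 = -1 / 2) (hB : ∀ j < 7, 1 ≤ j → bRat (ofList A) j = ofList B j)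
    {j : ℕ} (h1 : 1 ≤ j) (h6 : j ≤ 6) : b 1 a j = ofList B j := by
  have hl : lam 1 a = 2 := by
    have h := ha 0 (by norm_num)
    rw [zero_add] at h
    rw [lam, h, h0]
    norm_num
  rw [b_eq_bRat ha hl h6, hB j (by omega) h1]

theorem bWeight_eq_ofList {a : ℕ → ℝ} {B : List ℚ} (h0 : ofList B 0 = 1)
    (hB : ∀ j, 1 ≤ j → j ≤ 6 → b 1 a j = ofList B j) (i : Fin 7) :
    bWeight 1 a i = ofList B i := by
  unfold bWeight
  split_ifs with h
  · rw [h, h0, Rat.cast_one]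
  · exact hB i (by omega) (by omega)

/-- The rational numbers `c_0, c_1, …, c_5` are the entries of a list `L`. -/
def IsCList (B L : List ℚ) : Prop :=
  ofList L 0 = -ofList B 1 ∧ ∀ i < 5, ofList L (i + 1) = 1 / (i + 1 : ℚ) *
    (ofList B (i + 2) + ∑ h ∈ Finset.range (i + 1), aaRat (ofList B) h (i + 2) * ofList L h)

instance (B L : List ℚ) : Decidable (IsCList B L) := by
  unfold IsCList
  infer_instance

/-- The recursion determines the `c_i`, so a candidate list need only be checked against it; the
well-founded definition is never evaluated. -/
theorem c_eq_ofList {a : ℕ → ℝ} {B L : List ℚ} (h0 : ofList B 0 = 1)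
    (hB : ∀ j, 1 ≤ j → j ≤ 6 → b 1 a j = ofList B j) (hL : IsCList B L) (i : ℕ) (hi : i ≤ 5) :
    c 1 a i = ofList L i := by
  induction i using Nat.strong_induction_on with
  | _ i ih =>
    rcases i with _ | i
    · rw [c, hB 1 le_rfl (by norm_num), hL.1]
      push_cast
      rfl
    · rw [c, hB (i + 2) (by omega) (by omega), hL.2 i (by omega)]
      push_cast
      rw [← Fin.sum_univ_eq_sum_range
        (fun h : ℕ => ((aaRat (ofList B) h (i + 2) : ℚ) : ℝ) * ((ofList L h : ℚ) : ℝ))]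
      congr 2
      refine Finset.sum_congr rfl fun h _ => ?_
      rw [aa_eq_aaRat (bWeight_eq_ofList h0 hB) (by omega), ih h (by omega) (by omega)]

/-- The numbers `c_0, …, c_5` of `1 - exp (-x)`. -/
def cListF : List ℚ := [-1/3, 1/18, 1/135, -1/972, -71/27216, -8759/5103000]

/-- The numbers `c_0, …, c_5` of `log (1 + x)`. -/
def cListG : List ℚ := [1/3, 1/18, -1/135, -1/972, 71/27216, -8759/5103000]

/-- This and the next four facts are closed identities in `ℚ`, decided by kernel evaluation. -/
theorem bRat_f : ∀ j < 7, 1 ≤ j → bRat (ofList taylorF) j = ofList weightsF j := by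
  decide +kernel

theorem bRat_g : ∀ j < 7, 1 ≤ j → bRat (ofList taylorG) j = ofList weightsG j := by
  decide +kernel

theorem isCList_f : IsCList weightsF cListF := by
  decide +kernel

theorem isCList_g : IsCList weightsG cListG := by
  decide +kernel

theorem aaRat_f : ∀ j < 6, aaRat (ofList weightsF) 0 (j + 1) =
    ofList [1, -1/6, 0, 1/180, 0, -1/2835] j := by
  decide +kernel

/-! ### The polynomials `T_m` and `P_m`: recursions, reflection, explicit values -/

theorem T_succ (a : ℕ → ℝ) (m : ℕ) :
    T 1 a (m + 2) = Polynomial.C (b 1 a 1) * ∑ s ∈ Finset.range (m + 1),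
          Polynomial.C ((-1 : ℝ) ^ (m - s) / ((m + 1 - s : ℕ) : ℝ)) *
            powCoeff (fun i => T 1 a (i + 1)) (m + 1 - s) (m + 1)
        - Polynomial.C (c 1 a (m + 1))
        - ∑ p ∈ Finset.Icc 1 m, Polynomial.C (c 1 a p) * ∑ q ∈ Finset.Icc 1 (m + 1 - p),
            Polynomial.C (fall (-(p : ℝ)) q / (q.factorial : ℝ)) *
              powCoeff (fun i => T 1 a (i + 1)) q (m + 1 - p) := by
  have h : ∀ s, partSum (m + 1) (m + 1) s (fun i : Fin (m + 1) => T 1 a ((i : ℕ) + 1)) =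
      powCoeff (fun i => T 1 a (i + 1)) (m + 1 - s) (m + 1) :=
    fun s => partSum_eq_powCoeff le_rfl s fun i => T 1 a (i + 1)
  rw [T]
  simp only [h]
  refine congrArg₂ _ rfl ?_
  · refine Finset.sum_congr rfl fun p _ => ?_
    refine congrArg₂ _ rfl ?_
    refine Finset.sum_congr rfl fun q hq => ?_
    rw [Finset.mem_Icc] at hq
    rw [partSum_eq_powCoeff (by omega) _ fun i => T 1 a (i + 1)]
    rw [show m + 1 - p - (m + 1 - p - q) = q by omega]

theorem P_succ (a : ℕ → ℝ) (m : ℕ) (hm : m ≤ 4) :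
    P 1 a (m + 2) = ∑ s ∈ Finset.range (m + 2), Polynomial.C ((-1) ^ (m + 2 - s)) *
      powCoeff (fun i => (T 1 a (i + 1)).comp (-X)) (m + 2 - s) (m + 2) := by
  rw [P]
  refine Finset.sum_congr rfl fun s _ => ?_
  rw [Nat.cast_one, one_div_one, fall_neg_one_div,
    partSum_eq_powCoeff (by omega) _ fun i => (T 1 a (i + 1)).comp (Polynomial.C (-1) * X)]
  simp

theorem eval_T_succ (a : ℕ → ℝ) (m : ℕ) (t : ℝ) :
    (T 1 a (m + 2)).eval t = b 1 a 1 * ∑ s ∈ Finset.range (m + 1),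
          (-1 : ℝ) ^ (m - s) / ((m + 1 - s : ℕ) : ℝ) *
            powCoeff (fun i => (T 1 a (i + 1)).eval t) (m + 1 - s) (m + 1)
        - c 1 a (m + 1)
        - ∑ p ∈ Finset.Icc 1 m, c 1 a p * ∑ q ∈ Finset.Icc 1 (m + 1 - p),
            fall (-(p : ℝ)) q / (q.factorial : ℝ) *
              powCoeff (fun i => (T 1 a (i + 1)).eval t) q (m + 1 - p) := by
  have h := fun l m => map_powCoeff (evalRingHom t) (fun i => T 1 a (i + 1)) l m
  simp only [coe_evalRingHom] at h
  rw [T_succ]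
  simp only [eval_sub, eval_mul, eval_C, eval_finsetSum, h]

theorem eval_P_succ (a : ℕ → ℝ) (m : ℕ) (hm : m ≤ 4) (t : ℝ) :
    (P 1 a (m + 2)).eval t = ∑ s ∈ Finset.range (m + 2), (-1) ^ (m + 2 - s) *
      powCoeff (fun i => (T 1 a (i + 1)).eval (-t)) (m + 2 - s) (m + 2) := by
  have h := fun l m => map_powCoeff (evalRingHom t) (fun i => (T 1 a (i + 1)).comp (-X)) l m
  simp only [coe_evalRingHom, eval_comp, eval_neg, eval_X] at h
  rw [P_succ a m hm]
  simp only [eval_mul, eval_C, eval_finsetSum, h]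

/-- Every term of the recursion for `T_{m+2}` carries the same sign `(-1) ^ (m + 2)`: `b_1` is odd
and multiplies a sum of weight `m + 1`; `c_p` has sign `(-1) ^ (p + 1)` and multiplies a sum of
weight `m + 1 - p`. -/
theorem T_reflect {a a' : ℕ → ℝ} (hb : b 1 a' 1 = -b 1 a 1)
    (hc : ∀ i, 1 ≤ i → i ≤ 5 → c 1 a' i = (-1) ^ (i + 1) * c 1 a i) (m : ℕ) (hm : m ≤ 6) :
    T 1 a' m = (-1) ^ m * (T 1 a m).comp (-X) := by
  induction m using Nat.strong_induction_on with
  | _ m ih =>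
    match m with
    | 0 => simp [T]
    | 1 => simp [T]
    | m + 2 =>
      have hp : ∀ l k, k ≤ m + 1 → powCoeff (fun i => T 1 a' (i + 1)) l k =
          (-1) ^ k * (powCoeff (fun i => T 1 a (i + 1)) l k).comp (-X) := by
        intro l k hk
        have h := map_powCoeff (compRingHom (-X)) (fun i => T 1 a (i + 1)) l k
        rw [coe_compRingHom_apply] at h
        rw [h]
        exact powCoeff_scale _ _ _ _ _ fun i hi => ih (i + 1) (by omega) (by omega)
      rw [T_succ, T_succ, hb, hc (m + 1) (by omega) (by omega)]
      simp only [sub_comp, mul_comp, C_comp, Polynomial.sum_comp, mul_sub]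
      have h1 : (-1 : ℝ[X]) ^ (m + 2) = (-1) ^ m := by rw [pow_add]; norm_num
      congr 1
      · congr 1
        · rw [Finset.mul_sum, Finset.mul_sum, Finset.mul_sum]
          refine Finset.sum_congr rfl fun s _ => ?_
          rw [hp _ _ le_rfl, map_neg]
          ring
        · simp
      · rw [Finset.mul_sum]
        refine Finset.sum_congr rfl fun p hpm => ?_
        rw [Finset.mem_Icc] at hpm
        rw [hc p (by omega) (by omega), Finset.mul_sum, Finset.mul_sum, Finset.mul_sum]
        refine Finset.sum_congr rfl fun q _ => ?_
        rw [hp _ _ (by omega)]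
        have h2 : (-1 : ℝ[X]) ^ (m + 2) = (-1) ^ (p + 1) * (-1) ^ (m + 1 - p) := by
          rw [← pow_add]
          congr 1
          omega
        rw [h2]
        simp only [map_mul, map_pow, map_neg, map_one]
        ring

theorem P_reflect {a a' : ℕ → ℝ} (hb : b 1 a' 1 = -b 1 a 1)
    (hc : ∀ i, 1 ≤ i → i ≤ 5 → c 1 a' i = (-1) ^ (i + 1) * c 1 a i) (m : ℕ) (hm : m ≤ 6) :
    P 1 a' m = (-1) ^ m * (P 1 a m).comp (-X) := by
  match m with
  | 0 => simp [P]
  | 1 => simp [P]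
  | m + 2 =>
    rw [P_succ _ _ (by omega), P_succ _ _ (by omega), Polynomial.sum_comp, Finset.mul_sum]
    refine Finset.sum_congr rfl fun s _ => ?_
    have h := map_powCoeff (compRingHom (-X)) (fun i => (T 1 a (i + 1)).comp (-X))
      (m + 2 - s) (m + 2)
    rw [coe_compRingHom_apply] at h
    rw [mul_comp, C_comp, h, powCoeff_scale (-1) (fun i => (T 1 a' (i + 1)).comp (-X))
      (fun i => compRingHom (-X) ((T 1 a (i + 1)).comp (-X)))]
    · ring
    · intro i hi
      simp only [T_reflect hb hc (i + 1) (by omega), coe_compRingHom_apply, mul_comp, pow_comp,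
        neg_comp, one_comp]

theorem coeff_reflect (p : ℝ[X]) (m j : ℕ) :
    ((-1) ^ m * p.comp (-X)).coeff j = (-1) ^ (m + j) * p.coeff j := by
  have h : ((-1) ^ m * p.comp (-X) : ℝ[X]) = Polynomial.C ((-1) ^ m) * p.comp (-X) := by simp
  have h' : (-X : ℝ[X]) = Polynomial.C (-1) * X := by simp
  rw [h, h', coeff_C_mul, comp_C_mul_X_coeff, pow_add]
  ring

theorem eval_reflect (p : ℝ[X]) (m : ℕ) (t : ℝ) :
    ((-1) ^ m * p.comp (-X)).eval t = (-1) ^ m * p.eval (-t) := by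
  simp

theorem T_f {a : ℕ → ℝ} (hb : b 1 a 1 = 1 / 3) (h1 : c 1 a 1 = 1 / 18) (h2 : c 1 a 2 = 1 / 135)
    (h3 : c 1 a 3 = -1 / 972) (t : ℝ) : (T 1 a 2).eval t = 1 / 3 * t - 1 / 18 ∧
        (T 1 a 3).eval t = -1 / 6 * t ^ 2 + 1 / 6 * t - 7 / 270 ∧
        (T 1 a 4).eval t = 1 / 9 * t ^ 3 - 2 / 9 * t ^ 2 + 29 / 270 * t - 13 / 1215 := by
  have t1 : (T 1 a 1).eval t = t := by simp [T]
  have t2 : (T 1 a 2).eval t = 1 / 3 * t - 1 / 18 := by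
    rw [eval_T_succ]
    simp [powCoeff, hb, h1, t1]
  have t3 : (T 1 a 3).eval t = -1 / 6 * t ^ 2 + 1 / 6 * t - 7 / 270 := by
    rw [eval_T_succ]
    simp [powCoeff, Finset.sum_range_succ, hb, h1, h2, t1, t2, fall]
    ring
  refine ⟨t2, t3, ?_⟩
  rw [eval_T_succ]
  simp [powCoeff, Finset.sum_range_succ, Finset.sum_Icc_succ_top, Finset.prod_range_succ, hb, h1,
    h2, h3, t1, t2, t3, fall, Nat.factorial]
  ring

theorem P_f {a : ℕ → ℝ} (hb : b 1 a 1 = 1 / 3) (h1 : c 1 a 1 = 1 / 18) (h2 : c 1 a 2 = 1 / 135)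
    (h3 : c 1 a 3 = -1 / 972) (t : ℝ) : (P 1 a 2).eval t = t ^ 2 + 1 / 3 * t + 1 / 18 ∧
        (P 1 a 3).eval t = t ^ 3 + 5 / 6 * t ^ 2 + 5 / 18 * t + 7 / 270 ∧
        (P 1 a 4).eval t =
          t ^ 4 + 13 / 9 * t ^ 3 + 5 / 6 * t ^ 2 + 53 / 270 * t + 67 / 4860 := by
  have t1 : (T 1 a 1).eval (-t) = -t := by simp [T]
  obtain ⟨t2, t3, t4⟩ := T_f hb h1 h2 h3 (-t)
  refine ⟨?_, ?_, ?_⟩ <;>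
  · rw [eval_P_succ _ _ (by norm_num)]
    simp [powCoeff, Finset.sum_range_succ, t1, t2, t3, t4]
    ring

/-! ### The approximate Abel function and its functional equation -/

open Topology

theorem isBigO_mul_of_one {α : Type*} {l : Filter α} {f g h : α → ℝ}
    (hf : f =O[l] (fun _ => (1 : ℝ))) (hg : g =O[l] h) : (fun x => f x * g x) =O[l] h := by
  simpa using hf.mul hg

theorem isBigO_pow_sub_pow {α : Type*} {l : Filter α} {f g h : α → ℝ}
    (hf : f =O[l] (fun _ => (1 : ℝ))) (hg : g =O[l] (fun _ => (1 : ℝ)))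
    (hfg : (fun x => f x - g x) =O[l] h) (n : ℕ) :
    (fun x => f x ^ n - g x ^ n) =O[l] h := by
  induction n with
  | zero => simpa using isBigO_zero h l
  | succ n ih =>
    have hg' : (fun x => g x ^ n) =O[l] (fun _ => (1 : ℝ)) := by simpa using hg.pow n
    refine ((isBigO_mul_of_one hf ih).add (isBigO_mul_of_one hg' hfg)).congr_left fun x => ?_
    ring

/-- The Taylor expansion of `log (1 + t)` at the origin. -/
theorem log_one_add_isBigO (n : ℕ) :
    (fun t : ℝ => (∑ i ∈ Finset.range n, (-t) ^ (i + 1) / ((i : ℝ) + 1)) + Real.log (1 + t))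
      =O[𝓝 0] fun t => t ^ (n + 1) := by
  refine IsBigO.of_bound 2 ?_
  have h : ∀ᶠ t : ℝ in 𝓝 0, |t| < 1 / 2 := by
    have := (continuous_abs (G := ℝ)).tendsto 0
    rw [abs_zero] at this
    exact this.eventually (gt_mem_nhds (by norm_num))
  filter_upwards [h] with t ht
  have h1 := Real.abs_log_sub_add_sum_range_le (x := -t) (by rw [abs_neg]; linarith) n
  rw [sub_neg_eq_add, abs_neg] at h1
  rw [Real.norm_eq_abs, norm_pow, Real.norm_eq_abs]
  refine h1.trans ?_
  rw [div_le_iff₀ (by linarith)]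
  nlinarith [pow_nonneg (abs_nonneg t) (n + 1)]

/-- The approximate Abel function of `1 - exp (-x)` (for `σ = 1`) and of `log (1 + x)` (for
`σ = -1`). -/
noncomputable def abelFun (σ x : ℝ) : ℝ :=
  2 / x + σ / 3 * Real.log x + 1 / 36 * x + σ / 540 * x ^ 2 - 1 / 7776 * x ^ 3

/-- Valid on both sides of the origin because `Real.log` is even. -/
theorem abel_neg_one (x : ℝ) : abelFun (-1) x = -abelFun 1 (-x) := by
  simp only [abelFun, Real.log_neg_eq_log, div_neg]
  ring

theorem exp_quotient_isBigO :
    (fun x : ℝ => (1 - Real.exp (-x) - x) / x ^ 2 -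
      (-1 / 2 + 1 / 6 * x - 1 / 24 * x ^ 2 + 1 / 120 * x ^ 3 - 1 / 720 * x ^ 4))
      =O[𝓝[≠] 0] fun x => x ^ 5 := by
  have h1 : Tendsto (fun x : ℝ => -x) (𝓝[≠] 0) (𝓝 0) := by
    simpa using (continuous_neg.tendsto (0 : ℝ)).mono_left nhdsWithin_le_nhds
  have h2 := (Real.exp_sub_sum_range_isBigO_pow 7).comp_tendsto h1
  have h3 : (fun x : ℝ => x ^ 2 * ((1 - Real.exp (-x) - x) / x ^ 2 -
      (-1 / 2 + 1 / 6 * x - 1 / 24 * x ^ 2 + 1 / 120 * x ^ 3 - 1 / 720 * x ^ 4)))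
      =O[𝓝[≠] 0] fun x => x ^ 2 * x ^ 5 := by
    refine (h2.neg_left.congr' ?_ (Eventually.of_forall fun _ => rfl)).trans ?_
    · filter_upwards [self_mem_nhdsWithin] with x hx
      have hx : x ≠ 0 := hx
      simp [Finset.sum_range_succ, Nat.factorial]
      field_simp
      ring
    · refine IsBigO.of_bound 1 (Eventually.of_forall fun x => ?_)
      simp [← pow_add]
  refine (((isBigO_refl (fun x : ℝ => (x ^ 2)⁻¹) _).mul h3).congr' ?_ ?_)
  all_goals
    filter_upwards [self_mem_nhdsWithin] with x hx
    have hx : x ≠ 0 := hx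
    rw [← mul_assoc, inv_mul_cancel₀ (by positivity), one_mul]

/-- The polynomial part of the increment of the Abel function, where `1 - exp (-x)` is
`x * (1 + x * k)`. -/
theorem abel_increment {x k : ℝ} (hx : x ≠ 0) (hk : 1 + x * k ≠ 0) :
    abelFun 1 (x * (1 + x * k)) - abelFun 1 x - 1 =
      (2 * (-k + x * k ^ 2 - x ^ 2 * k ^ 3 + x ^ 3 * k ^ 4 - x ^ 4 * k ^ 5)
        + 1 / 3 * (x * k - 1 / 2 * x ^ 2 * k ^ 2 + 1 / 3 * x ^ 3 * k ^ 3 - 1 / 4 * x ^ 4 * k ^ 4)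
        + 1 / 36 * (x ^ 2 * k) + 1 / 540 * (2 * x ^ 3 * k + x ^ 4 * k ^ 2)
        - 1 / 7776 * (3 * x ^ 4 * k + 3 * x ^ 5 * k ^ 2 + x ^ 6 * k ^ 3) - 1)
      + 2 * k ^ 6 * (1 + x * k)⁻¹ * x ^ 5
      + 1 / 3 * ((∑ i ∈ Finset.range 4, (-(x * k)) ^ (i + 1) / ((i : ℝ) + 1))
          + Real.log (1 + x * k)) := by
  have h : 2 / (x * (1 + x * k)) - 2 / x = 2 * (-k + x * k ^ 2 - x ^ 2 * k ^ 3 + x ^ 3 * k ^ 4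
      - x ^ 4 * k ^ 5) + 2 * k ^ 6 * (1 + x * k)⁻¹ * x ^ 5 := by
    field_simp
    ring
  simp only [abelFun, Real.log_mul hx hk, Finset.sum_range_succ, Finset.sum_range_zero]
  linear_combination h

/-- The neighbourhood is two-sided because the case of `log (1 + x)` uses this estimate at negative
arguments. -/
theorem abel_f_isBigO :
    (fun x : ℝ => abelFun 1 (1 - Real.exp (-x)) - abelFun 1 x - 1) =O[𝓝[≠] 0] fun x => x ^ 5 := by
  set k : ℝ → ℝ := fun x => (1 - Real.exp (-x) - x) / x ^ 2 with hkdef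
  set k0 : ℝ → ℝ := fun x =>
    -1 / 2 + 1 / 6 * x - 1 / 24 * x ^ 2 + 1 / 120 * x ^ 3 - 1 / 720 * x ^ 4 with hk0def
  have hid : Tendsto (fun x : ℝ => x) (𝓝[≠] 0) (𝓝 0) := tendsto_id.mono_left nhdsWithin_le_nhds
  have cont : ∀ q : ℝ → ℝ, Continuous q → q =O[𝓝[≠] 0] (fun _ => (1 : ℝ)) := fun q hq =>
    ((hq.tendsto 0).mono_left nhdsWithin_le_nhds).isBigO_one ℝ
  have hkk0 : (fun x => k x - k0 x) =O[𝓝[≠] 0] fun x => x ^ 5 := exp_quotient_isBigO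
  have hk0 : k0 =O[𝓝[≠] 0] (fun _ => (1 : ℝ)) := cont _ (by fun_prop)
  have hk : k =O[𝓝[≠] 0] (fun _ => (1 : ℝ)) := by
    have := (hkk0.trans (cont (fun x => x ^ 5) (by fun_prop))).add hk0
    exact this.congr_left fun x => by ring
  have hpow := isBigO_pow_sub_pow hk hk0 hkk0
  have hx : (fun x : ℝ => x) =O[𝓝[≠] 0] (fun x => x) := isBigO_refl _ _
  have hxk : Tendsto (fun x => x * k x) (𝓝[≠] 0) (𝓝 0) := by
    have h := hx.mul hk
    simp only [mul_one] at h
    exact h.trans_tendsto hid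
  have h1xk : Tendsto (fun x => 1 + x * k x) (𝓝[≠] 0) (𝓝 1) := by
    simpa using hxk.const_add 1
  have hlog := (log_one_add_isBigO 4).comp_tendsto hxk
  have hlog' : (fun x => (∑ i ∈ Finset.range 4, (-(x * k x)) ^ (i + 1) / ((i : ℝ) + 1))
      + Real.log (1 + x * k x)) =O[𝓝[≠] 0] fun x => x ^ 5 := by
    refine hlog.trans ?_
    have h := (isBigO_refl (fun x : ℝ => x ^ 5) (𝓝[≠] 0)).mul (hk.pow 5)
    refine (h.congr_left fun x => ?_).congr_right fun x => ?_
    · simp [mul_pow]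
    · simp
  have hinv : (fun x => 2 * k x ^ 6 * (1 + x * k x)⁻¹ * x ^ 5) =O[𝓝[≠] 0] fun x => x ^ 5 := by
    refine isBigO_mul_of_one (isBigO_mul_of_one (isBigO_mul_of_one
      (isBigO_const_const 2 one_ne_zero _) ?_) ?_) (isBigO_refl _ _)
    · simpa using hk.pow 6
    · exact (h1xk.inv₀ one_ne_zero).isBigO_one ℝ
  have hpoly : (fun x => 2 * (-k x + x * k x ^ 2 - x ^ 2 * k x ^ 3 + x ^ 3 * k x ^ 4
        - x ^ 4 * k x ^ 5)
        + 1 / 3 * (x * k x - 1 / 2 * x ^ 2 * k x ^ 2 + 1 / 3 * x ^ 3 * k x ^ 3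
          - 1 / 4 * x ^ 4 * k x ^ 4)
        + 1 / 36 * (x ^ 2 * k x) + 1 / 540 * (2 * x ^ 3 * k x + x ^ 4 * k x ^ 2)
        - 1 / 7776 * (3 * x ^ 4 * k x + 3 * x ^ 5 * k x ^ 2 + x ^ 6 * k x ^ 3) - 1)
      =O[𝓝[≠] 0] fun x => x ^ 5 := by
    -- The polynomial part with `k` replaced by its Taylor polynomial `k0`. Its coefficients of `x⁰,
    -- …, x⁴` vanish, by the choice of the coefficients of `abelFun`; the bracket is the cofactor of
    -- `x ^ 5`.
    have hR : (fun x : ℝ => ((-905/31104) + (17407/388800) * x + (-173753/4665600) * x ^ 2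
        + (141749/6220800) * x ^ 3 + (-3762443/335923200) * x ^ 4 + (5171929/1119744000) * x ^ 5
        + (-612643/373248000) * x ^ 6 + (3437477/6718464000) * x ^ 7
        + (-1897937/13436928000) * x ^ 8 + (311309/8957952000) * x ^ 9
        + (-770483/100776960000) * x ^ 10 + (1212787/806215680000) * x ^ 11
        + (-212753/806215680000) * x ^ 12 + (595841/14511882240000) * x ^ 13
        + (-3769/671846400000) * x ^ 14 + (427/644972544000) * x ^ 15
        + (-53/806215680000) * x ^ 16 + (17/3224862720000) * x ^ 17
        + (-1/3224862720000) * x ^ 18 + (1/96745881600000) * x ^ 19) * x ^ 5)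
        =O[𝓝[≠] 0] fun x => x ^ 5 :=
      isBigO_mul_of_one (cont _ (by fun_prop)) (isBigO_refl _ _)
    have term : ∀ (q : ℝ → ℝ) (_ : Continuous q) (n : ℕ),
        (fun x => q x * (k x ^ n - k0 x ^ n)) =O[𝓝[≠] 0] fun x => x ^ 5 := fun q hq n =>
      isBigO_mul_of_one (cont q hq) (hpow n)
    -- Replacing `k` by `k0` is done separately for each power of `k`; the functions `q` collect the
    -- coefficients of `k, k², …, k⁵`.
    have t1 := term (fun x => -2 + 1 / 3 * x + 1 / 36 * x ^ 2 + 2 / 540 * x ^ 3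
      - 3 / 7776 * x ^ 4) (by fun_prop) 1
    have t2 := term (fun x => 2 * x - 1 / 6 * x ^ 2 + 1 / 540 * x ^ 4 - 3 / 7776 * x ^ 5)
      (by fun_prop) 2
    have t3 := term (fun x => -2 * x ^ 2 + 1 / 9 * x ^ 3 - 1 / 7776 * x ^ 6) (by fun_prop) 3
    have t4 := term (fun x => 2 * x ^ 3 - 1 / 12 * x ^ 4) (by fun_prop) 4
    have t5 := term (fun x => -2 * x ^ 4) (by fun_prop) 5
    refine (((((t1.add t2).add t3).add t4).add t5).add hR).congr_left fun x => ?_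
    simp only [hk0def]
    ring
  refine ((hpoly.add hinv).add (isBigO_mul_of_one
    (isBigO_const_const (1 / 3) one_ne_zero _) hlog')).congr' ?_ EventuallyEq.rfl
  filter_upwards [self_mem_nhdsWithin, h1xk.eventually_ne one_ne_zero] with x hx hne
  rw [← abel_increment hx hne]
  have hx : x ≠ 0 := hx
  have : x * (1 + x * k x) = 1 - Real.exp (-x) := by
    simp only [hkdef]
    field_simp
    ring
  rw [this]

/-- With `y = -log (1 + x)` one has `1 - exp (-y) = -x`; the estimate at `y` becomes this one by
`abel_neg_one`, and `|y| ≤ x`. -/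
theorem abel_g_isBigO :
    (fun x : ℝ => abelFun (-1) (Real.log (1 + x)) - abelFun (-1) x - 1) =O[𝓝[>] 0] fun x => x ^ 5 := by
  have hid : Tendsto (fun x : ℝ => x) (𝓝[>] 0) (𝓝 0) := tendsto_id.mono_left nhdsWithin_le_nhds
  have hlim : Tendsto (fun x : ℝ => -Real.log (1 + x)) (𝓝[>] 0) (𝓝[≠] 0) := by
    refine tendsto_nhdsWithin_iff.2 ⟨?_, ?_⟩
    · have h : Tendsto (fun x : ℝ => 1 + x) (𝓝[>] 0) (𝓝 1) := by simpa using hid.const_add 1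
      simpa using (h.log one_ne_zero).neg
    · filter_upwards [self_mem_nhdsWithin] with x hx
      have hx : 0 < x := hx
      exact neg_ne_zero.2 (Real.log_pos (by linarith)).ne'
  have h := abel_f_isBigO.comp_tendsto hlim
  refine (h.congr' ?_ EventuallyEq.rfl).trans ?_
  · filter_upwards [self_mem_nhdsWithin] with x hx
    have hx : 0 < x := hx
    have he : 1 - Real.exp (- -Real.log (1 + x)) = -x := by
      rw [neg_neg, Real.exp_log (by linarith)]
      ring
    simp only [Function.comp_apply, he, abel_neg_one]
    ring
  · refine IsBigO.of_bound 1 ?_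
    filter_upwards [self_mem_nhdsWithin] with x hx
    have hx : 0 < x := hx
    have h1 := Real.log_pos (show 1 < 1 + x by linarith)
    have h2 := Real.log_le_sub_one_of_pos (show 0 < 1 + x by linarith)
    rw [Function.comp_apply, norm_pow, norm_pow, Real.norm_eq_abs, Real.norm_eq_abs, abs_neg,
      abs_of_pos h1, abs_of_pos hx, one_mul]
    gcongr
    linarith

/-! ### From the Abel function back to the orbit -/

theorem mul_mul_log_sub_le {x y : ℝ} (hx : 0 < x) (hy : 0 < y) (hx1 : x ≤ 1) (hy1 : y ≤ 1) :
    |x * y * (Real.log x - Real.log y)| ≤ |x - y| := by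
  wlog h : y ≤ x generalizing x y
  · have := this hy hx hy1 hx1 (le_of_not_ge h)
    rwa [abs_sub_comm x y, ← abs_neg, show -(x * y * (Real.log x - Real.log y)) =
      y * x * (Real.log y - Real.log x) by ring]
  have h0 : 0 ≤ Real.log x - Real.log y := sub_nonneg.2 (Real.log_le_log hy h)
  rw [abs_of_nonneg (by positivity), abs_of_nonneg (sub_nonneg.2 h)]
  have h1 : Real.log x - Real.log y ≤ x / y - 1 := by
    rw [← Real.log_div hx.ne' hy.ne']
    exact Real.log_le_sub_one_of_pos (by positivity)
  calc x * y * (Real.log x - Real.log y) ≤ x * y * (x / y - 1) := by gcongr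
    _ = x * (x - y) := by field_simp
    _ ≤ 1 * (x - y) := by
      gcongr
    _ = x - y := one_mul _

/-- In `x * y * (A x - A y)` the term `2/x` contributes `-2 (x - y)`, while the logarithm and the
polynomial contribute at most `1/3` and `1/2` of `|x - y|`. The left over factor `2 - 1/3 - 1/2`
exceeds `1`. -/
theorem abs_sub_le_abelFun {σ x y : ℝ} (hσ : |σ| ≤ 1) (hx : 0 < x) (hy : 0 < y) (hx1 : x ≤ 1)
    (hy1 : y ≤ 1) : |x - y| ≤ x * y * |abelFun σ x - abelFun σ y| := by
  have hl := mul_mul_log_sub_le hx hy hx1 hy1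
  have e : 2 * (x - y) = -(x * y * (abelFun σ x - abelFun σ y))
      + σ / 3 * (x * y * (Real.log x - Real.log y))
      + x * y * (1 / 36 + σ / 540 * (x + y) - 1 / 7776 * (x ^ 2 + x * y + y ^ 2)) * (x - y) := by
    simp only [abelFun]
    field_simp
    ring
  have h1 : |σ / 3 * (x * y * (Real.log x - Real.log y))| ≤ 1 / 3 * |x - y| := by
    rw [abs_mul, abs_div, abs_of_pos (show (0 : ℝ) < 3 by norm_num)]
    gcongr
  have h2 : |x * y * (1 / 36 + σ / 540 * (x + y) - 1 / 7776 * (x ^ 2 + x * y + y ^ 2)) * (x - y)|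
      ≤ 1 / 2 * |x - y| := by
    rw [abs_mul]
    gcongr
    rw [abs_mul, abs_of_pos (mul_pos hx hy)]
    have hxy : x * y ≤ 1 := mul_le_one₀ hx1 hy.le hy1
    have hs : |σ / 540 * (x + y)| ≤ 1 / 540 * 2 := by
      rw [abs_mul, abs_div, abs_of_pos (show (0 : ℝ) < 540 by norm_num),
        abs_of_pos (show 0 < x + y by linarith)]
      gcongr
      linarith
    have hs' := abs_le.1 hs
    have : |1 / 36 + σ / 540 * (x + y) - 1 / 7776 * (x ^ 2 + x * y + y ^ 2)| ≤ 1 / 2 := by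
      rw [abs_le]
      constructor <;> nlinarith [mul_pos hx hy, sq_nonneg x, sq_nonneg y]
    calc _ ≤ 1 * (1 / 2) := mul_le_mul hxy this (abs_nonneg _) zero_le_one
      _ = 1 / 2 := one_mul _
  have h3 : |2 * (x - y)| ≤ x * y * |abelFun σ x - abelFun σ y| + 1 / 3 * |x - y|
      + 1 / 2 * |x - y| := by
    rw [e]
    refine (abs_add_le _ _).trans (add_le_add ((abs_add_le _ _).trans (add_le_add ?_ h1)) h2)
    rw [abs_neg, abs_mul, abs_of_pos (mul_pos hx hy)]
  rw [abs_mul, abs_of_pos (show (0 : ℝ) < 2 by norm_num)] at h3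
  linarith [abs_nonneg (x - y)]

theorem exists_limit_of_sub_isBigO {u : ℕ → ℝ}
    (hu : (fun n => u (n + 1) - u n) =O[atTop] fun n : ℕ => 1 / (n : ℝ) ^ 5) :
    ∃ K, (fun n => u n - K) =O[atTop] fun n : ℕ => 1 / (n : ℝ) ^ 4 := by
  have hs : Summable fun n => u (n + 1) - u n :=
    summable_of_isBigO_nat (Real.summable_one_div_nat_pow.2 (by norm_num)) hu
  have hlim : Tendsto u atTop (𝓝 ((∑' n, (u (n + 1) - u n)) + u 0)) := by
    refine (hs.hasSum.tendsto_sum_nat.add_const (u 0)).congr fun n => ?_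
    rw [Finset.sum_range_sub]
    ring
  refine ⟨(∑' n, (u (n + 1) - u n)) + u 0, ?_⟩
  · obtain ⟨M, hM⟩ := hu.bound
    obtain ⟨N, hN⟩ := eventually_atTop.1 hM
    have hM0 : 0 ≤ |M| := abs_nonneg M
    have step : ∀ n : ℕ, N ≤ n → 1 ≤ n →
        |u (n + 1) - u n| ≤ 4 * |M| * (1 / (n : ℝ) ^ 4 - 1 / ((n + 1 : ℕ) : ℝ) ^ 4) := by
      intro n hn h1
      have hn1 : (1 : ℝ) ≤ n := by exact_mod_cast h1
      have h := hN n hn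
      rw [Real.norm_eq_abs, Real.norm_eq_abs, abs_of_nonneg (by positivity : 0 ≤ 1 / (n : ℝ) ^ 5)]
        at h
      -- A telescoping majorant of `1 / n ^ 5`, which bounds the tail by a multiple of `1 / n ^ 4`.
      have h2 : 1 / (n : ℝ) ^ 5 ≤ 4 * (1 / (n : ℝ) ^ 4 - 1 / ((n + 1 : ℕ) : ℝ) ^ 4) := by
        push_cast
        have e : 4 * (1 / (n : ℝ) ^ 4 - 1 / ((n : ℝ) + 1) ^ 4) - 1 / (n : ℝ) ^ 5 =
            (15 * (n : ℝ) ^ 4 + 20 * n ^ 3 + 10 * n ^ 2 - 1 * 1) / (n ^ 5 * (n + 1) ^ 4) := by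
          field_simp
          ring
        have : 0 ≤ (15 * (n : ℝ) ^ 4 + 20 * n ^ 3 + 10 * n ^ 2 - 1 * 1)
            / (n ^ 5 * (n + 1) ^ 4) := by
          apply div_nonneg _ (by positivity)
          nlinarith [one_le_pow₀ hn1 (n := 4), one_le_pow₀ hn1 (n := 3), one_le_pow₀ hn1 (n := 2)]
        linarith
      calc |u (n + 1) - u n| ≤ M * (1 / (n : ℝ) ^ 5) := h
        _ ≤ |M| * (1 / (n : ℝ) ^ 5) := by
          gcongr
          exact le_abs_self M
        _ ≤ |M| * (4 * (1 / (n : ℝ) ^ 4 - 1 / ((n + 1 : ℕ) : ℝ) ^ 4)) := by gcongr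
        _ = _ := by ring
    have tail : ∀ n : ℕ, N ≤ n → 1 ≤ n → ∀ m, n ≤ m →
        |u m - u n| ≤ 4 * |M| * (1 / (n : ℝ) ^ 4 - 1 / (m : ℝ) ^ 4) := by
      intro n hn h1 m hm
      induction m, hm using Nat.le_induction with
      | base => simp
      | succ m hm ih =>
        have h := step m (hn.trans hm) (h1.trans hm)
        have := abs_add_le (u (m + 1) - u m) (u m - u n)
        rw [sub_add_sub_cancel] at this
        linarith
    refine IsBigO.of_bound (4 * |M|) ?_
    filter_upwards [eventually_ge_atTop N, eventually_ge_atTop 1] with n hn h1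
    rw [Real.norm_eq_abs, Real.norm_eq_abs, abs_of_nonneg (by positivity : 0 ≤ 1 / (n : ℝ) ^ 4),
      abs_sub_comm]
    refine le_of_tendsto (hlim.sub_const (u n)).abs ?_
    filter_upwards [eventually_ge_atTop n] with m hm
    refine (tail n hn h1 m hm).trans ?_
    gcongr
    have : 0 ≤ 1 / (m : ℝ) ^ 4 := by positivity
    linarith

theorem tendsto_mul_abelFun (σ : ℝ) : Tendsto (fun x => x * abelFun σ x) (𝓝[>] 0) (𝓝 2) := by
  have h1 : Tendsto (fun x : ℝ => Real.log x * x) (𝓝[>] 0) (𝓝 0) := by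
    simpa using tendsto_log_mul_rpow_nhdsGT_zero (r := 1) one_pos
  have h2 : Tendsto (fun x : ℝ => 1 / 36 * x ^ 2 + σ / 540 * x ^ 3 - 1 / 7776 * x ^ 4) (𝓝[>] 0)
      (𝓝 0) := by
    have h : Continuous fun x : ℝ => 1 / 36 * x ^ 2 + σ / 540 * x ^ 3 - 1 / 7776 * x ^ 4 := by
      fun_prop
    have := (h.tendsto 0).mono_left (nhdsWithin_le_nhds (s := Set.Ioi 0))
    simpa using this
  have h3 := ((h1.const_mul (σ / 3)).add h2).const_add 2
  simp only [mul_zero, add_zero] at h3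
  refine h3.congr' ?_
  filter_upwards [self_mem_nhdsWithin] with x hx
  have hx : 0 < x := hx
  simp only [abelFun]
  field_simp
  ring

/-- The approximate Abel function along an orbit that tends to the origin. -/
theorem abelFun_orbit {σ : ℝ} {h : ℝ → ℝ} {x : ℕ → ℝ} (hpos : ∀ n, 0 < x n)
    (hlim : Tendsto x atTop (𝓝 0)) (hrec : ∀ n, x (n + 1) = h (x n))
    (hh : (fun x => abelFun σ (h x) - abelFun σ x - 1) =O[𝓝[>] 0] fun x => x ^ 5) :
    (∃ K, (fun n => abelFun σ (x n) - n - K) =O[atTop] fun n : ℕ => 1 / (n : ℝ) ^ 4) ∧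
      Tendsto (fun n : ℕ => n * x n) atTop (𝓝 2) := by
  have hx : Tendsto x atTop (𝓝[>] 0) := tendsto_nhdsWithin_iff.2 ⟨hlim, Eventually.of_forall hpos⟩
  have hd : (fun n => abelFun σ (x (n + 1)) - abelFun σ (x n) - 1) =O[atTop] fun n => x n ^ 5 :=
    (hh.comp_tendsto hx).congr_left fun n => by simp [hrec]
  have hd0 : Tendsto (fun n => abelFun σ (x (n + 1)) - abelFun σ (x n) - 1) atTop (𝓝 0) :=
    hd.trans_tendsto (by simpa using hlim.pow 5)
  have h1 : Tendsto (fun n : ℕ => abelFun σ (x n) / n) atTop (𝓝 1) := by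
    -- The increments of `A (x_n)` tend to `1`, hence so do their averages; with `x * A x → 2` this
    -- gives `n * x n → 2`.
    have hc := hd0.cesaro
    have h2 := (hc.add (tendsto_inv_atTop_nhds_zero_nat.mul_const (abelFun σ (x 0)))).add_const 1
    simp only [zero_mul, add_zero, zero_add] at h2
    refine h2.congr' ?_
    filter_upwards [eventually_ge_atTop 1] with n hn
    have hn : (n : ℝ) ≠ 0 := by positivity
    rw [Finset.sum_sub_distrib, Finset.sum_range_sub fun n => abelFun σ (x n)]
    simp
    field_simp
    ring
  have h2 : Tendsto (fun n : ℕ => n * x n) atTop (𝓝 2) := by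
    have h3 := ((tendsto_mul_abelFun σ).comp hx).div h1 one_ne_zero
    rw [div_one] at h3
    refine h3.congr' ?_
    filter_upwards [h1.eventually_ne one_ne_zero] with n hn
    -- Division by zero yields `0`, so a nonzero quotient has both parts nonzero.
    have ha : abelFun σ (x n) ≠ 0 := fun h => hn (by simp [h])
    have hn : (n : ℝ) ≠ 0 := fun h => hn (by simp [h])
    change x n * abelFun σ (x n) / (abelFun σ (x n) / n) = n * x n
    field_simp
  refine ⟨exists_limit_of_sub_isBigO ?_, h2⟩
  have hxn : x =O[atTop] fun n : ℕ => 1 / (n : ℝ) := by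
    have h3 := (isBigO_refl (fun n : ℕ => 1 / (n : ℝ)) atTop).mul (h2.isBigO_one ℝ)
    refine h3.congr' ?_ (Eventually.of_forall fun n => mul_one _)
    filter_upwards [eventually_ge_atTop 1] with n hn
    have hn : (n : ℝ) ≠ 0 := by positivity
    field_simp
  refine (hd.congr_left fun n => ?_).trans ((hxn.pow 5).congr_right fun n => ?_)
  · push_cast
    ring
  · rw [div_pow, one_pow]

/-! ### Inverting the Abel function by an explicit expansion -/

/-- Here `a1, …, a4` are `P_1, …, P_4` homogenised by `β`. They solve the inversion equation order
by order in `r`: `low` says that the orders `r, …, r⁴` cancel. `D2, D3, D4` are the parts of `p²,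
p³, p⁴` divisible by `r⁵`, and `e` is the coefficient of `r⁴` in `p²`. -/
theorem scaled_expansion_identity (r a1 a2 a3 a4 α β p q e D2 D3 D4 : ℝ)
    (ha1 : a1 = α) (ha2 : a2 = α ^ 2 + 1 / 3 * α * β + 1 / 18 * β ^ 2)
    (ha3 : a3 = α ^ 3 + 5 / 6 * α ^ 2 * β + 5 / 18 * α * β ^ 2 + 7 / 270 * β ^ 3)
    (ha4 : a4 = α ^ 4 + 13 / 9 * α ^ 3 * β + 5 / 6 * α ^ 2 * β ^ 2 + 53 / 270 * α * β ^ 3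
      + 67 / 4860 * β ^ 4)
    (hq : q = a1 + r * a2 + r ^ 2 * a3 + r ^ 3 * a4) (hp : p = r * q)
    (he : e = 2 * a1 * a3 + a2 ^ 2)
    (hD2 : D2 = 2 * a1 * a4 + 2 * a2 * a3 + r * (2 * a2 * a4 + a3 ^ 2) + 2 * r ^ 2 * a3 * a4
      + r ^ 3 * a4 ^ 2)
    (hD3 : D3 = r * q * D2 + (a1 * e + 2 * a1 * a2 ^ 2 + a3 * a1 ^ 2)
      + r * (a2 * e + 2 * a1 * a2 * a3 + a4 * a1 ^ 2) + r ^ 2 * (a3 * e + 2 * a1 * a2 * a4)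
      + r ^ 3 * (a4 * e))
    (hD4 : D4 = r * q * D3 + 4 * a1 ^ 3 * a2 + r * (3 * a1 ^ 2 * a2 ^ 2 + a3 * a1 ^ 3)
      + r ^ 2 * (3 * a1 ^ 2 * a2 * a3 + a4 * a1 ^ 3) + r ^ 3 * (3 * a1 ^ 2 * a2 * a4)) :
    -p + p ^ 2 - p ^ 3 + p ^ 4 + r * α + (r * β) / 3 * (p - p ^ 2 / 2 + p ^ 3 / 3)
      + (r * β) ^ 2 / 18 * (1 + p) + (r * β) ^ 3 / 135 * (1 + p) ^ 2
      - (r * β) ^ 4 / 972 * (1 + p) ^ 3 =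
    (D2 - D3 + D4 + β / 3 * (a4 - 1 / 2 * (e + r * D2) + 1 / 3 * (3 * a1 ^ 2 * a2 + r * D3))
      + β ^ 2 / 18 * (a3 + r * a4) + β ^ 3 / 135 * (2 * (a2 + r * a3 + r ^ 2 * a4) + q ^ 2)
      - β ^ 4 / 972 * (3 * q + 3 * r * q ^ 2 + r ^ 2 * q ^ 3)) * r ^ 5 := by
  have h2 : p ^ 2 = r ^ 2 * a1 ^ 2 + 2 * r ^ 3 * a1 * a2 + r ^ 4 * e + r ^ 5 * D2 := by
    rw [hp, hq, he, hD2]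
    ring
  have h3 : p ^ 3 = r ^ 3 * a1 ^ 3 + 3 * r ^ 4 * a1 ^ 2 * a2 + r ^ 5 * D3 := by
    rw [pow_succ, h2, hp, hD3, hq]
    ring
  have h4 : p ^ 4 = r ^ 4 * a1 ^ 4 + r ^ 5 * D4 := by
    rw [pow_succ, h3, hp, hD4, hq]
    ring
  have low : r * (-a1 + α) + r ^ 2 * (-a2 + a1 ^ 2 + β * a1 / 3 + β ^ 2 / 18)
      + r ^ 3 * (-a3 + 2 * a1 * a2 - a1 ^ 3 + β / 3 * (a2 - a1 ^ 2 / 2) + β ^ 2 / 18 * a1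
        + β ^ 3 / 135)
      + r ^ 4 * (-a4 + e - 3 * a1 ^ 2 * a2 + a1 ^ 4 + β / 3 * (a3 - a1 * a2 + a1 ^ 3 / 3)
        + β ^ 2 / 18 * a2 + β ^ 3 / 135 * 2 * a1 - β ^ 4 / 972) = 0 := by
    rw [he, ha4, ha3, ha2, ha1]
    ring
  have h1 : p = r * a1 + r ^ 2 * a2 + r ^ 3 * a3 + r ^ 4 * a4 := by
    rw [hp, hq]
    ring
  have hs : (1 + p) ^ 2 = 1 + 2 * (r * a1 + r ^ 2 * a2 + r ^ 3 * a3 + r ^ 4 * a4)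
      + r ^ 2 * q ^ 2 := by
    rw [← h1, hp]
    ring
  have hc : (1 + p) ^ 3 = 1 + r * (3 * q + 3 * r * q ^ 2 + r ^ 2 * q ^ 3) := by
    rw [hp]
    ring
  rw [hs, hc, h4, h3, h2, h1]
  linear_combination low

theorem scaled_expansion_isBigO {r α β : ℕ → ℝ} (hr : Tendsto r atTop (𝓝 0))
    (hα : α =O[atTop] (fun _ => (1 : ℝ))) (hβ : β =O[atTop] (fun _ => (1 : ℝ))) (p : ℕ → ℝ)
    (hp : ∀ n, p n = r n * (α n + r n * (α n ^ 2 + 1 / 3 * α n * β n + 1 / 18 * β n ^ 2)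
      + r n ^ 2 * (α n ^ 3 + 5 / 6 * α n ^ 2 * β n + 5 / 18 * α n * β n ^ 2 + 7 / 270 * β n ^ 3)
      + r n ^ 3 * (α n ^ 4 + 13 / 9 * α n ^ 3 * β n + 5 / 6 * α n ^ 2 * β n ^ 2
        + 53 / 270 * α n * β n ^ 3 + 67 / 4860 * β n ^ 4))) :
    Tendsto p atTop (𝓝 0) ∧
    (fun n => (1 + p n)⁻¹ - 1 + r n * α n + (r n * β n) / 3 * Real.log (1 + p n)
      + (r n * β n) ^ 2 / 18 * (1 + p n) + (r n * β n) ^ 3 / 135 * (1 + p n) ^ 2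
      - (r n * β n) ^ 4 / 972 * (1 + p n) ^ 3) =O[atTop] fun n => r n ^ 5 := by
  have hr1 : r =O[atTop] (fun _ => (1 : ℝ)) := hr.isBigO_one ℝ
  have hconst : ∀ a : ℝ, (fun _ : ℕ => a) =O[atTop] (fun _ => (1 : ℝ)) := fun a =>
    isBigO_const_const a one_ne_zero _
  have hmul : ∀ {u v : ℕ → ℝ}, u =O[atTop] (fun _ => (1 : ℝ)) → v =O[atTop] (fun _ => (1 : ℝ)) →
    (fun n => u n * v n) =O[atTop] (fun _ => (1 : ℝ)) := fun hu hv => isBigO_mul_of_one hu hv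
  have hpow : ∀ {u : ℕ → ℝ} (k : ℕ), u =O[atTop] (fun _ => (1 : ℝ)) →
    (fun n => u n ^ k) =O[atTop] (fun _ => (1 : ℝ)) := fun k hu => by simpa using hu.pow k
  set a2 : ℕ → ℝ := fun n => α n ^ 2 + 1 / 3 * α n * β n + 1 / 18 * β n ^ 2 with ha2
  set a3 : ℕ → ℝ := fun n =>
    α n ^ 3 + 5 / 6 * α n ^ 2 * β n + 5 / 18 * α n * β n ^ 2 + 7 / 270 * β n ^ 3 with ha3
  set a4 : ℕ → ℝ := fun n => α n ^ 4 + 13 / 9 * α n ^ 3 * β n + 5 / 6 * α n ^ 2 * β n ^ 2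
        + 53 / 270 * α n * β n ^ 3 + 67 / 4860 * β n ^ 4 with ha4
  set q : ℕ → ℝ := fun n => α n + r n * a2 n + r n ^ 2 * a3 n + r n ^ 3 * a4 n with hq
  set e : ℕ → ℝ := fun n => 2 * α n * a3 n + a2 n ^ 2 with he
  set D2 : ℕ → ℝ := fun n => 2 * α n * a4 n + 2 * a2 n * a3 n
    + r n * (2 * a2 n * a4 n + a3 n ^ 2) + 2 * r n ^ 2 * a3 n * a4 n + r n ^ 3 * a4 n ^ 2 with hD2
  set D3 : ℕ → ℝ := fun n => r n * q n * D2 n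
      + (α n * e n + 2 * α n * a2 n ^ 2 + a3 n * α n ^ 2)
      + r n * (a2 n * e n + 2 * α n * a2 n * a3 n + a4 n * α n ^ 2)
      + r n ^ 2 * (a3 n * e n + 2 * α n * a2 n * a4 n)
      + r n ^ 3 * (a4 n * e n) with hD3
  set D4 : ℕ → ℝ := fun n => r n * q n * D3 n + 4 * α n ^ 3 * a2 n
      + r n * (3 * α n ^ 2 * a2 n ^ 2 + a3 n * α n ^ 3)
      + r n ^ 2 * (3 * α n ^ 2 * a2 n * a3 n + a4 n * α n ^ 3)
      + r n ^ 3 * (3 * α n ^ 2 * a2 n * a4 n) with hD4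
  have hp' : ∀ n, p n = r n * q n := hp
  have b2 : a2 =O[atTop] (fun _ => (1 : ℝ)) := by
    repeat first
      | assumption | apply IsBigO.add | apply IsBigO.neg_left | apply hmul
      | apply hpow | apply hconst
  have b3 : a3 =O[atTop] (fun _ => (1 : ℝ)) := by
    repeat first
      | assumption | apply IsBigO.add | apply IsBigO.neg_left | apply hmul
      | apply hpow | apply hconst
  have b4 : a4 =O[atTop] (fun _ => (1 : ℝ)) := by
    repeat first
      | assumption | apply IsBigO.add | apply IsBigO.neg_left | apply hmul
      | apply hpow | apply hconst
  have bq : q =O[atTop] (fun _ => (1 : ℝ)) := by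
    repeat first
      | assumption | apply IsBigO.add | apply IsBigO.neg_left | apply hmul
      | apply hpow | apply hconst
  have be : e =O[atTop] (fun _ => (1 : ℝ)) := by
    repeat first
      | assumption | apply IsBigO.add | apply IsBigO.neg_left | apply hmul
      | apply hpow | apply hconst
  have bD2 : D2 =O[atTop] (fun _ => (1 : ℝ)) := by
    repeat first
      | assumption | apply IsBigO.add | apply IsBigO.neg_left | apply hmul
      | apply hpow | apply hconst
  have bD3 : D3 =O[atTop] (fun _ => (1 : ℝ)) := by
    repeat first
      | assumption | apply IsBigO.add | apply IsBigO.neg_left | apply hmul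
      | apply hpow | apply hconst
  have bD4 : D4 =O[atTop] (fun _ => (1 : ℝ)) := by
    repeat first
      | assumption | apply IsBigO.add | apply IsBigO.neg_left | apply hmul
      | apply hpow | apply hconst
  have hpoly := isBigO_mul_of_one (f := fun n => D2 n - D3 n + D4 n
      + β n / 3 * (a4 n - 1 / 2 * (e n + r n * D2 n)
        + 1 / 3 * (3 * α n ^ 2 * a2 n + r n * D3 n))
      + β n ^ 2 / 18 * (a3 n + r n * a4 n)
      + β n ^ 3 / 135 * (2 * (a2 n + r n * a3 n + r n ^ 2 * a4 n) + q n ^ 2)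
      - β n ^ 4 / 972 * (3 * q n + 3 * r n * q n ^ 2 + r n ^ 2 * q n ^ 3)) (by
    simp only [div_eq_mul_inv]
    repeat first
      | assumption | apply IsBigO.add | apply IsBigO.neg_left | apply hmul
      | apply hpow | apply hconst)
    (isBigO_refl (fun n => r n ^ 5) atTop)
  have hpr : p =O[atTop] r := by
    refine ((isBigO_refl r atTop).mul bq).congr (fun n => (hp' n).symm) fun n => mul_one _
  have hp0 : Tendsto p atTop (𝓝 0) := hpr.trans_tendsto hr
  have h1p : Tendsto (fun n => 1 + p n) atTop (𝓝 1) := by simpa using hp0.const_add 1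
  refine ⟨hp0, ?_⟩
  have hlog := (log_one_add_isBigO 3).comp_tendsto hp0
  -- The prefactor `r n` supplies one order, so the logarithm is needed only to third order.
  have hlog' : (fun n => β n / 3 * (r n * ((∑ i ∈ Finset.range 3, (-p n) ^ (i + 1) / ((i : ℝ) + 1))
      + Real.log (1 + p n)))) =O[atTop] fun n => r n ^ 5 := by
    refine isBigO_mul_of_one ?_ ((isBigO_refl r atTop).mul (hlog.trans (hpr.pow 4)) |>.congr_right
      fun n => by ring)
    simp only [div_eq_mul_inv]
    exact hmul hβ (hconst _)
  have hinv : (fun n => -(1 + p n)⁻¹ * p n ^ 5) =O[atTop] fun n => r n ^ 5 :=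
    isBigO_mul_of_one ((h1p.inv₀ one_ne_zero).isBigO_one ℝ).neg_left (hpr.pow 5)
  refine ((hpoly.add hlog').add hinv).congr' ?_ EventuallyEq.rfl
  filter_upwards [h1p.eventually_ne one_ne_zero] with n hn
  rw [← scaled_expansion_identity (r n) (α n) (a2 n) (a3 n) (a4 n) (α n) (β n) (p n) (q n) (e n)
    (D2 n) (D3 n) (D4 n) rfl rfl rfl rfl rfl (hp' n) rfl rfl rfl rfl]
  have hi : (1 + p n)⁻¹ = 1 - p n + p n ^ 2 - p n ^ 3 + p n ^ 4 - (1 + p n)⁻¹ * p n ^ 5 := by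
    field_simp
    ring
  simp only [Finset.sum_range_succ, Finset.sum_range_zero]
  linear_combination -hi

/-- The leading terms of the expansion of the iterates, with `Z = -(σ / 3 * log n + K)`. -/
noncomputable def blocks (σ Z n : ℝ) : ℝ :=
  Z / n + (Z ^ 2 + σ / 3 * Z + 1 / 18) / n ^ 2
    + (Z ^ 3 + 5 / 6 * σ * Z ^ 2 + 5 / 18 * Z + 7 / 270 * σ) / n ^ 3
    + (Z ^ 4 + 13 / 9 * σ * Z ^ 3 + 5 / 6 * Z ^ 2 + 53 / 270 * σ * Z + 67 / 4860) / n ^ 4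

/-- At `2/n * (1 + p)` the coefficients `1/36, 1/540, 1/7776` are multiplied by `2, 4, 8`, giving
`1/18, 1/135, 1/972`. Since `σ² = 1`, the signs are absorbed into powers of `σ / n`. -/
theorem abelFun_two_div_mul {σ : ℝ} (hσ : σ ^ 2 = 1) {K n p : ℝ} (hn : n ≠ 0) (hp : 1 + p ≠ 0) :
    abelFun σ (2 / n * (1 + p)) - n - (K + σ / 3 * Real.log 2) =
      n * ((1 + p)⁻¹ - 1 + -(σ / 3 * Real.log n + K) / n + σ / n / 3 * Real.log (1 + p)
        + (σ / n) ^ 2 / 18 * (1 + p) + (σ / n) ^ 3 / 135 * (1 + p) ^ 2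
        - (σ / n) ^ 4 / 972 * (1 + p) ^ 3) := by
  have hs3 : σ ^ 3 = σ := by rw [pow_succ, hσ, one_mul]
  have hs4 : σ ^ 4 = 1 := by rw [pow_succ, hs3, ← sq, hσ]
  rw [abelFun, Real.log_mul (by positivity) hp, Real.log_div two_ne_zero hn]
  simp only [div_pow, hσ, hs3, hs4]
  field_simp
  ring

theorem abelFun_blocks {σ : ℝ} (hσ : σ ^ 2 = 1) (K : ℝ) :
    Tendsto (fun n : ℕ => blocks σ (-(σ / 3 * Real.log n + K)) n) atTop (𝓝 0) ∧
    (fun n : ℕ => abelFun σ (2 / n * (1 + blocks σ (-(σ / 3 * Real.log n + K)) n))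
      - n - (K + σ / 3 * Real.log 2)) =O[atTop]
      fun n : ℕ => Real.log n ^ 5 / (n : ℝ) ^ 4 := by
  have hlogtop : Tendsto (fun n : ℕ => Real.log n) atTop atTop :=
    Real.tendsto_log_atTop.comp tendsto_natCast_atTop_atTop
  have hloginv : Tendsto (fun n : ℕ => (Real.log n)⁻¹) atTop (𝓝 0) :=
    tendsto_inv_atTop_zero.comp hlogtop
  have hne : ∀ᶠ n : ℕ in atTop, (n : ℝ) ≠ 0 ∧ Real.log n ≠ 0 := by
    filter_upwards [hlogtop.eventually_gt_atTop 0, eventually_ge_atTop 1] with n h1 h2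
    exact ⟨by positivity, h1.ne'⟩
  have hr : Tendsto (fun n : ℕ => Real.log n / n) atTop (𝓝 0) := by
    have h := Real.isLittleO_log_id_atTop.tendsto_div_nhds_zero.comp
      (tendsto_natCast_atTop_atTop (R := ℝ))
    exact h
  -- With `r = log n / n` these choices give `r α = Z / n` and `r β = σ / n` with `α, β` bounded.
  -- Thus the logarithms sit in `r`, and the error `n * r⁵` is `log⁵ n / n⁴`.
  have hα : (fun n : ℕ => -(σ / 3 + K * (Real.log n)⁻¹)) =O[atTop] (fun _ => (1 : ℝ)) :=
    ((hloginv.const_mul K).const_add (σ / 3)).neg.isBigO_one ℝ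
  have hβ : (fun n : ℕ => σ * (Real.log n)⁻¹) =O[atTop] (fun _ => (1 : ℝ)) :=
    (hloginv.const_mul σ).isBigO_one ℝ
  obtain ⟨hp0, hE⟩ := scaled_expansion_isBigO hr hα hβ _ fun n => rfl
  have hs3 : σ ^ 3 = σ := by rw [pow_succ, hσ, one_mul]
  have hs4 : σ ^ 4 = 1 := by rw [pow_succ, hs3, ← sq, hσ]
  have e1 : ∀ n : ℕ, (n : ℝ) ≠ 0 → Real.log n ≠ 0 →
      Real.log n / n * -(σ / 3 + K * (Real.log n)⁻¹) = -(σ / 3 * Real.log n + K) / n := by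
    intro n hn hl
    field_simp
  have e2 : ∀ n : ℕ, (n : ℝ) ≠ 0 → Real.log n ≠ 0 →
      Real.log n / n * (σ * (Real.log n)⁻¹) = σ / n := by
    intro n hn hl
    field_simp
  have hblocks : ∀ (r α β Z n : ℝ), n ≠ 0 → r * α = Z / n → r * β = σ / n →
      r * (α + r * (α ^ 2 + 1 / 3 * α * β + 1 / 18 * β ^ 2)
        + r ^ 2 * (α ^ 3 + 5 / 6 * α ^ 2 * β + 5 / 18 * α * β ^ 2 + 7 / 270 * β ^ 3)
        + r ^ 3 * (α ^ 4 + 13 / 9 * α ^ 3 * β + 5 / 6 * α ^ 2 * β ^ 2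
        + 53 / 270 * α * β ^ 3 + 67 / 4860 * β ^ 4)) = blocks σ Z n := by
    intro r α β Z n hn h1 h2
    calc _ = (r * α) + ((r * α) ^ 2 + 1 / 3 * (r * α) * (r * β) + 1 / 18 * (r * β) ^ 2)
        + ((r * α) ^ 3 + 5 / 6 * (r * α) ^ 2 * (r * β) + 5 / 18 * (r * α) * (r * β) ^ 2
          + 7 / 270 * (r * β) ^ 3)
        + ((r * α) ^ 4 + 13 / 9 * (r * α) ^ 3 * (r * β) + 5 / 6 * (r * α) ^ 2 * (r * β) ^ 2
        + 53 / 270 * (r * α) * (r * β) ^ 3 + 67 / 4860 * (r * β) ^ 4) := by ring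
      _ = _ := by
        rw [h1, h2]
        simp only [blocks, div_pow, hs3, hs4, hσ]
        ring
  have hp' : ∀ᶠ n : ℕ in atTop, _ = blocks σ (-(σ / 3 * Real.log n + K)) n :=
    hne.mono fun n hn => hblocks _ _ _ _ _ hn.1 (e1 n hn.1 hn.2) (e2 n hn.1 hn.2)
  have hb0 := hp0.congr' hp'
  refine ⟨hb0, ?_⟩
  have h1b : Tendsto (fun n : ℕ => 1 + blocks σ (-(σ / 3 * Real.log n + K)) n) atTop (𝓝 1) := by
    simpa using hb0.const_add 1
  refine ((isBigO_refl (fun n : ℕ => (n : ℝ)) atTop).mul hE).congr' ?_ ?_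
  · filter_upwards [hp', hne, h1b.eventually (lt_mem_nhds one_pos)] with n h1 h2 h3
    rw [abelFun_two_div_mul hσ h2.1 h3.ne', h1, e1 n h2.1 h2.2, e2 n h2.1 h2.2]
  · filter_upwards [hne] with n hn
    have := hn.1
    field_simp

theorem iterates_expand {σ K' : ℝ} (hσ : σ ^ 2 = 1) {x : ℕ → ℝ}
    (hx : (fun n => abelFun σ (x n) - n - K') =O[atTop] fun n : ℕ => 1 / (n : ℝ) ^ 4)
    (hlim : Tendsto (fun n : ℕ => n * x n) atTop (𝓝 2)) :
    (fun n : ℕ => x n - 2 / n * (1 + blocks σ (-(σ / 3 * Real.log n +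
      (K' - σ / 3 * Real.log 2))) n)) =O[atTop] fun n : ℕ => Real.log n ^ 5 / (n : ℝ) ^ 6 := by
  obtain ⟨hb0, hA⟩ := abelFun_blocks hσ (K' - σ / 3 * Real.log 2)
  set A : ℕ → ℝ := fun n =>
    2 / n * (1 + blocks σ (-(σ / 3 * Real.log n + (K' - σ / 3 * Real.log 2))) n) with hAdef
  have hA2 : Tendsto (fun n : ℕ => n * A n) atTop (𝓝 2) := by
    have h := (hb0.const_add 1).const_mul 2
    rw [add_zero, mul_one] at h
    refine h.congr' ?_
    filter_upwards [eventually_ge_atTop 1] with n hn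
    have hn : (n : ℝ) ≠ 0 := by positivity
    simp only [hAdef]
    field_simp
  have hlogtop : Tendsto (fun n : ℕ => Real.log n) atTop atTop :=
    Real.tendsto_log_atTop.comp tendsto_natCast_atTop_atTop
  have hx' : (fun n => abelFun σ (x n) - n - K') =O[atTop]
      fun n : ℕ => Real.log n ^ 5 / (n : ℝ) ^ 4 := by
    refine hx.trans (IsBigO.of_bound 1 ?_)
    filter_upwards [hlogtop.eventually_ge_atTop 1] with n hn
    rw [one_mul, Real.norm_of_nonneg (by positivity), Real.norm_of_nonneg (by positivity)]
    gcongr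
    exact one_le_pow₀ hn
  have hd : (fun n => abelFun σ (x n) - abelFun σ (A n)) =O[atTop]
      fun n : ℕ => Real.log n ^ 5 / (n : ℝ) ^ 4 := by
    refine (hx'.sub hA).congr_left fun n => ?_
    simp only [hAdef]
    ring
  have hσ1 : |σ| ≤ 1 := by
    rw [← sq_le_one_iff_abs_le_one]
    exact hσ.le
  have hsmall : ∀ {y : ℕ → ℝ}, Tendsto (fun n : ℕ => n * y n) atTop (𝓝 2) →
      ∀ᶠ n : ℕ in atTop, 0 < y n ∧ y n ≤ 1 ∧ y n ≤ 3 / n := by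
    intro y hy
    filter_upwards [hy.eventually (lt_mem_nhds (show (1 : ℝ) < 2 by norm_num)),
      hy.eventually (gt_mem_nhds (show (2 : ℝ) < 3 by norm_num)), eventually_ge_atTop 3]
      with n h1 h2 h3
    have h3' : (3 : ℝ) ≤ n := by exact_mod_cast h3
    have hn : (0 : ℝ) < n := by linarith
    have h4 : y n ≤ 3 / n := by
      rw [le_div_iff₀ hn]
      linarith
    refine ⟨?_, h4.trans ((div_le_one hn).2 h3'), h4⟩
    by_contra h
    nlinarith
  -- Both points are at most `3 / n`, so their product supplies the factor `9 / n²`.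
  have hprod : (fun n => x n - A n) =O[atTop]
      fun n : ℕ => (1 / (n : ℝ) ^ 2) * (abelFun σ (x n) - abelFun σ (A n)) := by
    refine IsBigO.of_bound 9 ?_
    filter_upwards [hsmall hlim, hsmall hA2] with n h1 h2
    rw [Real.norm_eq_abs, norm_mul, Real.norm_of_nonneg (by positivity), Real.norm_eq_abs]
    refine (abs_sub_le_abelFun hσ1 h1.1 h2.1 h1.2.1 h2.2.1).trans ?_
    rw [← mul_assoc (9 : ℝ)]
    refine mul_le_mul_of_nonneg_right ?_ (abs_nonneg _)
    calc x n * A n ≤ 3 / n * (3 / n) :=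
          mul_le_mul h1.2.2 h2.2.2 h2.1.le (h1.1.le.trans h1.2.2)
      _ = 9 * (1 / (n : ℝ) ^ 2) := by ring
  refine (hprod.trans ((isBigO_refl _ _).mul hd)).congr_right fun n => ?_
  ring

/-! ### Expansion of the iterates of both functions -/

theorem approx_eq_blocks {σ : ℝ} {a : ℕ → ℝ} (hl : lam 1 a = 2) (hb : b 1 a 1 = σ / 3)
    (hP : ∀ t : ℝ, (P 1 a 2).eval t = t ^ 2 + σ / 3 * t + 1 / 18 ∧
        (P 1 a 3).eval t = t ^ 3 + 5 / 6 * σ * t ^ 2 + 5 / 18 * t + 7 / 270 * σ ∧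
        (P 1 a 4).eval t =
          t ^ 4 + 13 / 9 * σ * t ^ 3 + 5 / 6 * t ^ 2 + 53 / 270 * σ * t + 67 / 4860)
    (K : ℝ) (n : ℕ) :
    approx 1 a 4 K n = 2 / n * (1 + blocks σ (-(σ / 3 * Real.log n + K)) n) := by
  obtain ⟨h2, h3, h4⟩ := hP (-(σ / 3 * Real.log n + K))
  have h1 : (P 1 a 1).eval (-(σ / 3 * Real.log n + K)) = -(σ / 3 * Real.log n + K) := by simp [P]
  simp only [approx, Nat.cast_one, div_one, Real.rpow_one, hl, hb, neg_one_mul, blocks]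
  rw [show Finset.Icc 1 4 = {1, 2, 3, 4} by decide, Finset.sum_insert (by decide),
    Finset.sum_insert (by decide), Finset.sum_insert (by decide), Finset.sum_singleton, h1, h2,
    h3, h4]
  ring

/-- The orbit decreases and its limit is a fixed point of `h`; only `0` is possible. -/
theorem orbit_tendsto_zero {h : ℝ → ℝ} (hc : ∀ x, 0 ≤ x → ContinuousAt h x)
    (hpos : ∀ x, 0 < x → 0 < h x) (hlt : ∀ x, 0 < x → h x < x) {x : ℕ → ℝ} (h0 : 0 < x 0)
    (hrec : ∀ n, x (n + 1) = h (x n)) : (∀ n, 0 < x n) ∧ Tendsto x atTop (𝓝 0) := by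
  have hx : ∀ n, 0 < x n := by
    intro n
    induction n with
    | zero => exact h0
    | succ n ih => exact hrec n ▸ hpos _ ih
  refine ⟨hx, ?_⟩
  have hanti : Antitone x := antitone_nat_of_succ_le fun n => (hrec n ▸ hlt _ (hx n)).le
  have hlim := tendsto_atTop_ciInf hanti ⟨0, by rintro _ ⟨n, rfl⟩; exact (hx n).le⟩
  set L := ⨅ n, x n
  have hL : 0 ≤ L := ge_of_tendsto' hlim fun n => (hx n).le
  have h1 : Tendsto (fun n => x (n + 1)) atTop (𝓝 (h L)) :=
    ((hc L hL).tendsto.comp hlim).congr fun n => (hrec n).symm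
  have h2 : h L = L := tendsto_nhds_unique h1 ((tendsto_add_atTop_iff_nat 1).2 hlim)
  rcases hL.eq_or_lt with h3 | h3
  · rwa [← h3] at hlim
  · exact absurd h2 (hlt L h3).ne

theorem iteratedDeriv_f (n : ℕ) : iteratedDeriv (n + 1) (fun x : ℝ => 1 - Real.exp (-x)) =
    fun x => (-1) ^ n * Real.exp (-x) := by
  induction n with
  | zero =>
    ext x
    have h : HasDerivAt (fun x : ℝ => 1 - Real.exp (-x)) (-(Real.exp (-x) * -1)) x :=
      ((hasDerivAt_neg x).exp).const_sub 1
    simp [h.deriv]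
  | succ n ih =>
    rw [iteratedDeriv_succ, ih]
    ext x
    have h : HasDerivAt (fun x : ℝ => (-1) ^ n * Real.exp (-x)) ((-1) ^ n * (Real.exp (-x) * -1)) x :=
      ((hasDerivAt_neg x).exp).const_mul _
    rw [h.deriv]
    ring

theorem taylorCoeff_f {i : ℕ} (hi : i < 7) :
    taylorCoeff (fun x : ℝ => 1 - Real.exp (-x)) 1 (i + 1) = ofList taylorF i := by
  rw [taylorCoeff, mul_one, iteratedDeriv_f]
  interval_cases i <;> norm_num [ofList, taylorF, Nat.factorial]

theorem taylorCoeff_g {i : ℕ} (hi : i < 7) :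
    taylorCoeff (fun x : ℝ => Real.log (1 + x)) 1 (i + 1) = ofList taylorG i := by
  -- Valid for every `x`, also `x = -1`, where both sides are `0` by convention.
  have h1 : deriv (fun x : ℝ => Real.log (1 + x)) = fun x => (1 * x + 1)⁻¹ := by
    ext x
    rw [deriv_comp_const_add (f := Real.log), Real.deriv_log, one_mul, add_comm]
  rw [taylorCoeff, mul_one, iteratedDeriv_succ', h1, iteratedDeriv_eq_iterate,
    iter_deriv_inv_linear]
  interval_cases i <;> norm_num [ofList, taylorG, Nat.factorial]

theorem exists_expansion {σ : ℝ} (hσ : σ ^ 2 = 1) {h : ℝ → ℝ} {a : ℕ → ℝ}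
    (hl : lam 1 a = 2) (hb : b 1 a 1 = σ / 3)
    (hP : ∀ t : ℝ, (P 1 a 2).eval t = t ^ 2 + σ / 3 * t + 1 / 18 ∧
        (P 1 a 3).eval t = t ^ 3 + 5 / 6 * σ * t ^ 2 + 5 / 18 * t + 7 / 270 * σ ∧
        (P 1 a 4).eval t =
          t ^ 4 + 13 / 9 * σ * t ^ 3 + 5 / 6 * t ^ 2 + 53 / 270 * σ * t + 67 / 4860)
    (hh : (fun x => abelFun σ (h x) - abelFun σ x - 1) =O[𝓝[>] 0] fun x => x ^ 5)
    (hc : ∀ x, 0 ≤ x → ContinuousAt h x)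
    (hpos : ∀ x, 0 < x → 0 < h x) (hlt : ∀ x, 0 < x → h x < x) {x₀ : ℝ} (h0 : 0 < x₀) :
    ∃ K, (fun n : ℕ => h^[n] x₀ - approx 1 a 4 K n) =O[atTop]
      fun n : ℕ => Real.log n ^ 5 / (n : ℝ) ^ 6 := by
  have hrec : ∀ n, h^[n + 1] x₀ = h (h^[n] x₀) := fun n => Function.iterate_succ_apply' h n x₀
  obtain ⟨hx, hlim⟩ := orbit_tendsto_zero (x := fun n => h^[n] x₀) hc hpos hlt h0 hrec
  obtain ⟨⟨K', hK'⟩, hn⟩ := abelFun_orbit hx hlim hrec hh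
  -- The shift comes from `log (2 / n)` in the Abel function at the trial value.
  refine ⟨K' - σ / 3 * Real.log 2, ?_⟩
  simp only [approx_eq_blocks hl hb hP]
  exact iterates_expand hσ hK' hn

theorem exists_expansion_f {a : ℕ → ℝ} (hl : lam 1 a = 2) (hb : b 1 a 1 = 1 / 3)
    (hP : ∀ t : ℝ, (P 1 a 2).eval t = t ^ 2 + 1 / 3 * t + 1 / 18 ∧
        (P 1 a 3).eval t = t ^ 3 + 5 / 6 * t ^ 2 + 5 / 18 * t + 7 / 270 ∧
        (P 1 a 4).eval t =
          t ^ 4 + 13 / 9 * t ^ 3 + 5 / 6 * t ^ 2 + 53 / 270 * t + 67 / 4860)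
    {x₀ : ℝ} (h0 : 0 < x₀) :
    ∃ K, (fun n : ℕ => (fun x : ℝ => 1 - Real.exp (-x))^[n] x₀ - approx 1 a 4 K n) =O[atTop]
      fun n : ℕ => Real.log n ^ 5 / (n : ℝ) ^ 6 := by
  refine exists_expansion (σ := 1) (one_pow 2) hl hb (by simpa only [mul_one] using hP)
    (abel_f_isBigO.mono (nhdsWithin_mono _ fun x (hx : 0 < x) => hx.ne'))
    (fun x _ => by fun_prop) (fun x hx => ?_) (fun x hx => ?_) h0
  · simpa using hx
  · have := Real.add_one_lt_exp (x := -x) (by linarith)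
    linarith

theorem exists_expansion_g {a : ℕ → ℝ} (hl : lam 1 a = 2) (hb : b 1 a 1 = -1 / 3)
    (hP : ∀ t : ℝ, (P 1 a 2).eval t = t ^ 2 - 1 / 3 * t + 1 / 18 ∧
        (P 1 a 3).eval t = t ^ 3 - 5 / 6 * t ^ 2 + 5 / 18 * t - 7 / 270 ∧
        (P 1 a 4).eval t =
          t ^ 4 - 13 / 9 * t ^ 3 + 5 / 6 * t ^ 2 - 53 / 270 * t + 67 / 4860)
    {x₀ : ℝ} (h0 : 0 < x₀) :
    ∃ K, (fun n : ℕ => (fun x : ℝ => Real.log (1 + x))^[n] x₀ - approx 1 a 4 K n) =O[atTop]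
      fun n : ℕ => Real.log n ^ 5 / (n : ℝ) ^ 6 := by
  refine exists_expansion (σ := -1) (by norm_num) hl hb (fun t => ?_)
    abel_g_isBigO (fun x hx => ?_) (fun x hx => ?_) (fun x hx => ?_) h0
  · obtain ⟨h2, h3, h4⟩ := hP t
    rw [h2, h3, h4]
    refine ⟨?_, ?_, ?_⟩ <;> ring
  · exact ContinuousAt.log (by fun_prop) (by positivity)
  · exact Real.log_pos (by linarith)
  · have := Real.log_lt_sub_one_of_pos (show 0 < 1 + x by linarith) (by linarith)
    linarith

theorem iteratesExpand_of_forall {h : ℝ → ℝ}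
    (H : ∀ x₀ : ℝ, 0 < x₀ → ∃ K, (fun n : ℕ => h^[n] x₀ - approx 1 (taylorCoeff h 1) 4 K n)
      =O[atTop] fun n : ℕ => Real.log n ^ 5 / (n : ℝ) ^ 6) : IteratesExpand h 1 4 := by
  refine ⟨1, one_pos, fun x₀ h0 _ => ?_⟩
  obtain ⟨K, hK⟩ := H x₀ h0
  refine ⟨K, hK.congr_right fun n => ?_⟩
  have h6 : ((4 : ℕ) : ℝ) + 1 + 1 / ((1 : ℕ) : ℝ) = ((6 : ℕ) : ℝ) := by norm_num
  rw [h6, Real.rpow_natCast]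

end IterAsymp

/-! ### The main theorem -/

theorem mainTheorem6 (f : ℝ → ℝ) (hf : ∀ x, f x = 1 - Real.exp (-x))
    (a : ℕ → ℝ) (ha : a = IterAsymp.taylorCoeff f 1) :
    -- the parameters
    ((a 1 = -1 / 2 ∧ a 2 = 1 / 6 ∧ a 3 = -1 / 24 ∧ a 4 = 1 / 120 ∧ a 5 = -1 / 720 ∧
        a 6 = 1 / 5040 ∧ a 7 = -1 / 40320) ∧
      IterAsymp.lam 1 a = 2 ∧
      (IterAsymp.b 1 a 1 = 1 / 3 ∧ IterAsymp.b 1 a 2 = 0 ∧ IterAsymp.b 1 a 3 = -1 / 45 ∧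
        IterAsymp.b 1 a 4 = 0 ∧ IterAsymp.b 1 a 5 = 2 / 945 ∧ IterAsymp.b 1 a 6 = 0) ∧
      (IterAsymp.aa 1 a 0 1 = 1 ∧ IterAsymp.aa 1 a 0 2 = -1 / 6 ∧ IterAsymp.aa 1 a 0 3 = 0 ∧
        IterAsymp.aa 1 a 0 4 = 1 / 180 ∧ IterAsymp.aa 1 a 0 5 = 0 ∧
        IterAsymp.aa 1 a 0 6 = -1 / 2835) ∧
      (IterAsymp.c 1 a 1 = 1 / 18 ∧ IterAsymp.c 1 a 2 = 1 / 135 ∧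
        IterAsymp.c 1 a 3 = -1 / 972 ∧ IterAsymp.c 1 a 4 = -71 / 27216 ∧
        IterAsymp.c 1 a 5 = -8759 / 5103000) ∧
      (∀ t : ℝ, (IterAsymp.T 1 a 2).eval t = 1 / 3 * t - 1 / 18 ∧
        (IterAsymp.T 1 a 3).eval t = -1 / 6 * t ^ 2 + 1 / 6 * t - 7 / 270 ∧
        (IterAsymp.T 1 a 4).eval t =
          1 / 9 * t ^ 3 - 2 / 9 * t ^ 2 + 29 / 270 * t - 13 / 1215) ∧
      (∀ t : ℝ, (IterAsymp.P 1 a 2).eval t = t ^ 2 + 1 / 3 * t + 1 / 18 ∧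
        (IterAsymp.P 1 a 3).eval t = t ^ 3 + 5 / 6 * t ^ 2 + 5 / 18 * t + 7 / 270 ∧
        (IterAsymp.P 1 a 4).eval t =
          t ^ 4 + 13 / 9 * t ^ 3 + 5 / 6 * t ^ 2 + 53 / 270 * t + 67 / 4860)) ∧
    -- the expansion of the iterates, in the form with the `P_m` and in explicit form
    (∀ x₀ : ℝ, 0 < x₀ → ∃ C : ℝ, ∀ x : ℕ → ℝ, x 0 = x₀ → (∀ n, x (n + 1) = f (x n)) →
      ((fun n : ℕ => x n - IterAsymp.approx 1 a 4 (-(2 * C)) n) =O[atTop]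
        (fun n : ℕ => Real.log n ^ 5 / (n : ℝ) ^ 6)) ∧
      ((fun n : ℕ => x n -
        (2 / (n : ℝ) - 2 / 3 * (Real.log n / (n : ℝ) ^ 2) + 4 * C / (n : ℝ) ^ 2
          + 2 / 9 * (Real.log n ^ 2 / (n : ℝ) ^ 3)
          - (8 / 3 * C + 2 / 9) * (Real.log n / (n : ℝ) ^ 3)
          + (8 * C ^ 2 + 4 / 3 * C + 1 / 9) * (1 / (n : ℝ) ^ 3)
          - 2 / 27 * (Real.log n ^ 3 / (n : ℝ) ^ 4)
          + (4 / 3 * C + 5 / 27) * (Real.log n ^ 2 / (n : ℝ) ^ 4)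
          - (8 * C ^ 2 + 20 / 9 * C + 5 / 27) * (Real.log n / (n : ℝ) ^ 4)
          + (16 * C ^ 3 + 20 / 3 * C ^ 2 + 10 / 9 * C + 7 / 135) * (1 / (n : ℝ) ^ 4)
          + 2 / 81 * (Real.log n ^ 4 / (n : ℝ) ^ 5)
          - (16 / 27 * C + 26 / 243) * (Real.log n ^ 3 / (n : ℝ) ^ 5)
          + (16 / 3 * C ^ 2 + 52 / 27 * C + 5 / 27) * (Real.log n ^ 2 / (n : ℝ) ^ 5)
          - (64 / 3 * C ^ 3 + 104 / 9 * C ^ 2 + 20 / 9 * C + 53 / 405) *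
              (Real.log n / (n : ℝ) ^ 5)
          + (32 * C ^ 4 + 208 / 9 * C ^ 3 + 20 / 3 * C ^ 2 + 106 / 135 * C + 67 / 2430) *
              (1 / (n : ℝ) ^ 5))) =O[atTop]
        (fun n : ℕ => Real.log n ^ 5 / (n : ℝ) ^ 6))) ∧
    -- kindredness with the logarithm
    IterAsymp.Kindred (fun x => Real.log (1 + x)) f 1 4 := by
  obtain rfl : f = fun x => 1 - Real.exp (-x) := funext hf
  have haF : ∀ i < 7, a (i + 1) = IterAsymp.ofList IterAsymp.taylorF i := fun i hi => by
    rw [ha, IterAsymp.taylorCoeff_f hi]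
  obtain ⟨g, hg⟩ : ∃ g : ℕ → ℝ, g = IterAsymp.taylorCoeff (fun x => Real.log (1 + x)) 1 := ⟨_, rfl⟩
  have hgG : ∀ i < 7, g (i + 1) = IterAsymp.ofList IterAsymp.taylorG i := fun i hi => by
    rw [hg, IterAsymp.taylorCoeff_g hi]
  have hbF := fun j => IterAsymp.b_eq_ofList (j := j) haF
    (by norm_num [IterAsymp.ofList, IterAsymp.taylorF]) IterAsymp.bRat_f
  have hbG := fun j => IterAsymp.b_eq_ofList (j := j) hgG
    (by norm_num [IterAsymp.ofList, IterAsymp.taylorG]) IterAsymp.bRat_g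
  have hcF := IterAsymp.c_eq_ofList (by norm_num [IterAsymp.ofList, IterAsymp.weightsF]) hbF
    IterAsymp.isCList_f
  have hcG := IterAsymp.c_eq_ofList (by norm_num [IterAsymp.ofList, IterAsymp.weightsG]) hbG
    IterAsymp.isCList_g
  have haaF : ∀ j < 6, IterAsymp.aa 1 a 0 (j + 1) =
      IterAsymp.ofList [1, -1/6, 0, 1/180, 0, -1/2835] j := fun j hj => by
    rw [IterAsymp.aa_eq_aaRat (IterAsymp.bWeight_eq_ofList
      (by norm_num [IterAsymp.ofList, IterAsymp.weightsF]) hbF) (by omega),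
      IterAsymp.aaRat_f j hj]
  have hA : a 1 = -1 / 2 ∧ a 2 = 1 / 6 ∧ a 3 = -1 / 24 ∧ a 4 = 1 / 120 ∧ a 5 = -1 / 720 ∧
      a 6 = 1 / 5040 ∧ a 7 = -1 / 40320 := by
    refine ⟨?_, ?_, ?_, ?_, ?_, ?_, ?_⟩ <;>
    · refine (haF _ (by norm_num)).trans ?_
      norm_num [IterAsymp.ofList, IterAsymp.taylorF]
  have hB : IterAsymp.b 1 a 1 = 1 / 3 ∧ IterAsymp.b 1 a 2 = 0 ∧ IterAsymp.b 1 a 3 = -1 / 45 ∧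
      IterAsymp.b 1 a 4 = 0 ∧ IterAsymp.b 1 a 5 = 2 / 945 ∧ IterAsymp.b 1 a 6 = 0 := by
    refine ⟨?_, ?_, ?_, ?_, ?_, ?_⟩ <;>
    · rw [hbF _ (by norm_num) (by norm_num)]
      norm_num [IterAsymp.ofList, IterAsymp.weightsF]
  have hC : IterAsymp.c 1 a 1 = 1 / 18 ∧ IterAsymp.c 1 a 2 = 1 / 135 ∧
      IterAsymp.c 1 a 3 = -1 / 972 ∧ IterAsymp.c 1 a 4 = -71 / 27216 ∧
      IterAsymp.c 1 a 5 = -8759 / 5103000 := by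
    refine ⟨?_, ?_, ?_, ?_, ?_⟩ <;>
    · rw [hcF _ (by norm_num)]
      norm_num [IterAsymp.ofList, IterAsymp.cListF]
  have hlF : IterAsymp.lam 1 a = 2 := IterAsymp.lam_f hA.1
  have hlG : IterAsymp.lam 1 g = 2 := IterAsymp.lam_f <| (hgG 0 (by norm_num)).trans <| by
    norm_num [IterAsymp.ofList, IterAsymp.taylorG]
  have hb1G : IterAsymp.b 1 g 1 = -1 / 3 := by
    rw [hbG _ (by norm_num) (by norm_num)]
    norm_num [IterAsymp.ofList, IterAsymp.weightsG]
  have hbneg : IterAsymp.b 1 a 1 = -IterAsymp.b 1 g 1 := by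
    rw [hb1G, hB.1]
    norm_num
  have hcsign : ∀ i, 1 ≤ i → i ≤ 5 →
      IterAsymp.c 1 a i = (-1) ^ (i + 1) * IterAsymp.c 1 g i := by
    intro i h1 h5
    -- The signs of the `c_i` are read off from the two computed lists.
    rw [hcF i h5, hcG i h5]
    interval_cases i <;> norm_num [IterAsymp.ofList, IterAsymp.cListF, IterAsymp.cListG]
  have hTF := IterAsymp.T_f hB.1 hC.1 hC.2.1 hC.2.2.1
  have hPF := IterAsymp.P_f hB.1 hC.1 hC.2.1 hC.2.2.1
  have hPsign := IterAsymp.P_reflect hbneg hcsign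
  have hPeval : ∀ m ≤ 6, ∀ t : ℝ,
      (IterAsymp.P 1 a m).eval t = (-1) ^ m * (IterAsymp.P 1 g m).eval (-t) := fun m hm t => by
    rw [hPsign m hm, IterAsymp.eval_reflect]
  have hPG : ∀ t : ℝ, (IterAsymp.P 1 g 2).eval t = t ^ 2 - 1 / 3 * t + 1 / 18 ∧
      (IterAsymp.P 1 g 3).eval t = t ^ 3 - 5 / 6 * t ^ 2 + 5 / 18 * t - 7 / 270 ∧
      (IterAsymp.P 1 g 4).eval t =
        t ^ 4 - 13 / 9 * t ^ 3 + 5 / 6 * t ^ 2 - 53 / 270 * t + 67 / 4860 := by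
    intro t
    obtain ⟨h2, h3, h4⟩ := hPF (-t)
    -- The polynomials of the logarithm are obtained by reflecting those of `1 - exp (-x)`.
    rw [hPeval _ (by norm_num), neg_neg] at h2 h3 h4
    refine ⟨?_, ?_, ?_⟩
    · linear_combination h2
    · linear_combination -h3
    · linear_combination h4
  have hexpF := fun x₀ (h0 : 0 < x₀) => IterAsymp.exists_expansion_f hlF hB.1 hPF h0
  have hexpG := fun x₀ (h0 : 0 < x₀) => IterAsymp.exists_expansion_g hlG hb1G hPG h0
  refine ⟨⟨hA, hlF, hB, ?_, hC, hTF, hPF⟩, ?_, ?_⟩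
  · refine ⟨?_, ?_, ?_, ?_, ?_, ?_⟩ <;>
    · refine (haaF _ (by norm_num)).trans ?_
      norm_num [IterAsymp.ofList]
  · intro x₀ h0
    obtain ⟨K, hK⟩ := hexpF x₀ h0
    -- `approx` contains `b_1 ln n + K`, the theorem `b_1 ln n - 2 C`.
    refine ⟨-K / 2, fun x hx0 hx => ?_⟩
    have hxn : ∀ n, x n = (fun x : ℝ => 1 - Real.exp (-x))^[n] x₀ := by
      intro n
      induction n with
      | zero => exact hx0
      | succ n ih => rw [hx, ih, Function.iterate_succ_apply']
    have hK1 : (fun n : ℕ => x n - IterAsymp.approx 1 a 4 (-(2 * (-K / 2))) n) =O[atTop]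
        (fun n : ℕ => Real.log n ^ 5 / (n : ℝ) ^ 6) := by
      simpa only [hxn, show -(2 * (-K / 2)) = K by ring] using hK
    refine ⟨hK1, hK1.congr_left fun n => ?_⟩
    rw [IterAsymp.approx_eq_blocks (σ := 1) hlF hB.1 (by simpa only [mul_one] using hPF)]
    simp only [IterAsymp.blocks]
    ring
  · rw [ha, hg] at *
    exact
      { expand_left := IterAsymp.iteratesExpand_of_forall hexpG
        expand_right := IterAsymp.iteratesExpand_of_forall hexpF
        lam_eq := hlG.trans hlF.symm
        c_eq := hcsign
        T_eq := fun m _ hm j => by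
          rw [IterAsymp.T_reflect hbneg hcsign m hm, IterAsymp.coeff_reflect]
        P_eq := fun m _ hm j => by
          rw [hPsign m hm, IterAsymp.coeff_reflect]
        block := fun m _ hm l K => by
          rw [hPeval m hm, hbneg]
          congr 2
          ring }
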